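/- Let $\Sigma=\{a,b\}$, let $\mathbb V=\{ab^ia \mid i\ge 1\}$, $\mathbb E=\{ab^iaaab^ja\mid i,j\ge 1\}$ and $\mathbb G=(\mathbb V\cup\mathbb E)^*\subseteq\Sigma^*$. A word $w\in\Sigma^*$ represents the finite directed graph $\rho(w)=(V(w),E(w))$, where $V(w)$ is the set of words $ab^ma$ with $m\ge1$ that are factors of $w$, and $E(w)$ is the set of pairs $(ab^ma,ab^na)$ with $m,n\ge1$ such that $ab^maaab^na$ is a factor of $w$. For $L\subseteq\Sigma^*$ put $\rho(L)=\{\rho(w)\mid w\in L\}$, graphs being considered up to isomorphism. For $t,p\in\mathbb N$ with $p\ge1$, a language $L\subseteq\Sigma^*$ satisfies the $(b,t,p)$-torsion property if $b^t\equiv_L b^{t+p}$, where $u\equiv_L v$ means that $xuy\in L\Leftrightarrow xvy\in L$ for all $x,y\in\Sigma^*$. If $L\subseteq\mathbb G$ is context-free and satisfies the $(b,t,p)$-torsion property for some $t,p\in\mathbb N$ with $p\ge1$, then a regular set $R\subseteq\mathbb G$ with $\rho(R)=\rho(L)$ can be computed effectively: there is a total computable function which maps every context-free grammar over $\Sigma$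 together with numbers $t,p\in\mathbb N$ to a nondeterministic finite automaton such that, whenever $p\ge1$ and the language $L$ generated by the grammar is contained in $\mathbb G$ and satisfies the $(b,t,p)$-torsion property, the regular language $R$ accepted by the automaton satisfies $R\subseteq\mathbb G$ and $\rho(R)=\rho(L)$. The last equality holds even for the sets of concrete graphs $(V(w),E(w))$, without identification of isomorphic graphs. -/

import Mathlib

/-! ### Words over the alphabet with the two letters `a` and `b` -/

/-- The alphabet `Σ = {a, b}`; the letter `a` is `false` and the letter `b` is `true`. -/
abbrev Letter : Type := Bool

/-- The letter `a`. -/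
abbrev letterA : Letter := false

/-- The letter `b`. -/
abbrev letterB : Letter := true

/-- The word `b ^ n`. -/
def bPow (n : ℕ) : List Letter := List.replicate n letterB

/-- The word `a b^m a`. -/
def vertexWord (m : ℕ) : List Letter := letterA :: (bPow m ++ [letterA])

/-- The word `a b^m a a a b^n a`. -/
def edgeWord (m n : ℕ) : List Letter := vertexWord m ++ letterA :: vertexWord n

/-- The set of vertex codes `{a b^i a | 1 ≤ i}`. -/
def vertexCodes : Language Letter := {w | ∃ i : ℕ, 1 ≤ i ∧ w = vertexWord i}

/-- The set of edge codes `{a b^i a a a b^j a | 1 ≤ i, j}`. -/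
def edgeCodes : Language Letter := {w | ∃ i j : ℕ, 1 ≤ i ∧ 1 ≤ j ∧ w = edgeWord i j}

/-- The regular set `𝔾 = (𝕍 ∪ 𝔼)*` of words representing graphs. -/
def graphWords : Language Letter := KStar.kstar (vertexCodes + edgeCodes)

/-! ### Graphs represented by words -/

/-- A directed graph `(V, E)` with `V` a set of elements of `α` and `E ⊆ V × V`. -/
@[ext]
structure SetGraph (α : Type) where
  /-- The set of vertices. -/
  verts : Set α
  /-- The set of edges. -/
  edges : Set (α × α)
  edges_subset : edges ⊆ verts ×ˢ verts

/-- The edge relation, on the vertex set. -/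
def SetGraph.Adj {α : Type} (G : SetGraph α) (x y : G.verts) : Prop :=
  ((x : α), (y : α)) ∈ G.edges

/-- Isomorphism of directed graphs. -/
def SetGraph.Isomorphic {α : Type} (G H : SetGraph α) : Prop :=
  Nonempty (G.Adj ≃r H.Adj)

/-- Isomorphism is an equivalence relation. -/
instance SetGraph.isoSetoid (α : Type) : Setoid (SetGraph α) where
  r := SetGraph.Isomorphic
  iseqv :=
    ⟨fun G => ⟨RelIso.refl G.Adj⟩, fun ⟨e⟩ => ⟨e.symm⟩, fun ⟨e⟩ ⟨f⟩ => ⟨e.trans f⟩⟩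

/-- The graph `ρ(w) = (V(w), E(w))` represented by a word `w`: its vertices are the factors
`a b^m a` of `w` with `1 ≤ m`, and there is an edge from `a b^m a` to `a b^n a`
if `a b^m a a a b^n a` is a factor of `w`. (`u <:+: w` says that `u` is a factor of `w`.) -/
def wordGraph (w : List Letter) : SetGraph (List Letter) where
  verts := {x | ∃ m : ℕ, 1 ≤ m ∧ x = vertexWord m ∧ vertexWord m <:+: w}
  edges := {e | ∃ m n : ℕ, 1 ≤ m ∧ 1 ≤ n ∧ e = (vertexWord m, vertexWord n) ∧
    edgeWord m n <:+: w}
  edges_subset := by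
    rintro e ⟨m, n, hm, hn, rfl, h⟩
    refine ⟨⟨m, hm, rfl, List.IsInfix.trans ?_ h⟩, ⟨n, hn, rfl, List.IsInfix.trans ?_ h⟩⟩
    · exact (List.prefix_append _ _).isInfix
    · exact ((List.suffix_cons _ _).trans (List.suffix_append _ _)).isInfix

/-- `{ρ(w) | w ∈ L}` as a set of concrete graphs, whose vertices are words. -/
def labelledRho (L : Language Letter) : Set (SetGraph (List Letter)) :=
  {G | ∃ w ∈ L, G = wordGraph w}

/-- `ρ(L) = {ρ(w) | w ∈ L}`, where graphs are considered up to isomorphism. -/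
def rho (L : Language Letter) : Set (Quotient (SetGraph.isoSetoid (List Letter))) :=
  {c | ∃ w ∈ L, c = Quotient.mk _ (wordGraph w)}

/-! ### The torsion property -/

/-- The syntactic congruence of a language: `u ≡_L v`. -/
def SyntacticEquiv {α : Type} (L : Language α) (u v : List α) : Prop :=
  ∀ x y : List α, x ++ u ++ y ∈ L ↔ x ++ v ++ y ∈ L

/-- The `(b, t, p)`-torsion property: `b^t ≡_L b^(t+p)`. It is used for `1 ≤ p` only. -/
def TorsionProperty (L : Language Letter) (t p : ℕ) : Prop :=
  SyntacticEquiv L (bPow t) (bPow (t + p))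

/-! ### Finite descriptions of context-free and of regular languages

Algorithms act on finite objects. The types of descriptions below are built from `ℕ` and `Bool`
with products, sums and lists, so that they carry Mathlib's standard encoding (`Primcodable`), and
`Computable` applies to functions between them. -/

/-- A description of a context-free grammar with terminals `a, b` and nonterminals in `ℕ`:
the initial nonterminal and the list of rules; in right-hand sides, `Sum.inl N` is the
nonterminal `N` and `Sum.inr c` is the letter `c`. -/
abbrev GrammarCode : Type := ℕ × List (ℕ × List (ℕ ⊕ Letter))

/-- The symbol that is described by an entry of the right-hand side of a rule. -/
def decodeSymbol : ℕ ⊕ Letter → Symbol Letter ℕ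
  | Sum.inl N => Symbol.nonterminal N
  | Sum.inr c => Symbol.terminal c

/-- The context-free grammar with a given description. -/
def GrammarCode.toGrammar (g : GrammarCode) : ContextFreeGrammar Letter where
  NT := ℕ
  initial := g.1
  rules := (g.2.map fun r => (⟨r.1, r.2.map decodeSymbol⟩ : ContextFreeRule Letter ℕ)).toFinset

theorem GrammarCode.mem_rules (g : GrammarCode) (r : ContextFreeRule Letter ℕ) :
    r ∈ g.toGrammar.rules ↔
      r ∈ g.2.map fun r => (⟨r.1, r.2.map decodeSymbol⟩ : ContextFreeRule Letter ℕ) :=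
  List.mem_toFinset

/-- The language generated by a grammar that is given by its description. -/
def GrammarCode.language (g : GrammarCode) : Language Letter := g.toGrammar.language

/-- A description of a nondeterministic finite automaton over `{a, b}`: the number `n` of states,
the list of transitions, the list of start states and the list of accepting states. -/
abbrev NFACode : Type := ℕ × List (ℕ × Letter × ℕ) × List ℕ × List ℕ

/-- The automaton with a given description; its states are `0, …, n - 1`. -/
def NFACode.toNFA (M : NFACode) : NFA Letter (Fin M.1) where
  step q c := {q' | ((q : ℕ), c, (q' : ℕ)) ∈ M.2.1}
  start := {q | (q : ℕ) ∈ M.2.2.1}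
  accept := {q | (q : ℕ) ∈ M.2.2.2}

/-- The language accepted by an automaton that is given by its description. -/
def NFACode.language (M : NFACode) : Language Letter := M.toNFA.accepts

/-- The action of a renaming of the nonterminals on symbols. -/
def renameSymbol {T N N' : Type} (φ : N → N') : Symbol T N → Symbol T N'
  | Symbol.nonterminal n => Symbol.nonterminal (φ n)
  | Symbol.terminal a => Symbol.terminal a

/-- Renaming the nonterminals does not change the language, if the renaming is injective on the
nonterminals that occur in the grammar. -/
theorem language_eq_of_rename {T : Type} (G G' : ContextFreeGrammar T) (φ : G.NT → G'.NT)
    (S : Set G.NT) (hφ : Set.InjOn φ S) (h0 : G.initial ∈ S) (hinit : G'.initial = φ G.initial)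
    (hin : ∀ r ∈ G.rules, r.input ∈ S)
    (hout : ∀ r ∈ G.rules, ∀ N, Symbol.nonterminal N ∈ r.output → N ∈ S)
    (hrules : ∀ r' : ContextFreeRule T G'.NT, r' ∈ G'.rules ↔
      ∃ r ∈ G.rules, r' = ⟨φ r.input, r.output.map (renameSymbol φ)⟩) :
    G'.language = G.language := by
  have fwd : ∀ u v, G.Derives u v →
      G'.Derives (u.map (renameSymbol φ)) (v.map (renameSymbol φ)) := by
    intro u v h
    induction h with
    | refl => exact Relation.ReflTransGen.refl
    | tail _ h ih =>
      refine ih.tail ?_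
      obtain ⟨r, hr, h⟩ := h
      obtain ⟨x, y, rfl, rfl⟩ := h.exists_parts
      refine ⟨⟨φ r.input, r.output.map (renameSymbol φ)⟩, (hrules _).2 ⟨r, hr, rfl⟩, ?_⟩
      have := ContextFreeRule.rewrites_of_exists_parts
        (⟨φ r.input, r.output.map (renameSymbol φ)⟩ : ContextFreeRule T G'.NT)
        (x.map (renameSymbol φ)) (y.map (renameSymbol φ))
      simpa [renameSymbol] using this
  have bwd : ∀ u v', (∀ N, Symbol.nonterminal N ∈ u → N ∈ S) →
      G'.Derives (u.map (renameSymbol φ)) v' →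
      ∃ v, v' = v.map (renameSymbol φ) ∧ (∀ N, Symbol.nonterminal N ∈ v → N ∈ S) ∧
        G.Derives u v := by
    intro u v' hu h
    induction h with
    | refl => exact ⟨u, rfl, hu, Relation.ReflTransGen.refl⟩
    | tail _ h ih =>
      obtain ⟨v, rfl, hv, hd⟩ := ih
      obtain ⟨r', hr', h⟩ := h
      obtain ⟨r, hr, rfl⟩ := (hrules r').1 hr'
      obtain ⟨x', y', hx, rfl⟩ := h.exists_parts
      rw [List.append_assoc] at hx
      obtain ⟨x, z, rfl, rfl, hz⟩ := List.map_eq_append_iff.1 hx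
      obtain ⟨s, y, rfl, hs, rfl⟩ := List.map_eq_cons_iff.1 hz
      have hs' : s = Symbol.nonterminal r.input := by
        cases s with
        | terminal a => simp [renameSymbol] at hs
        | nonterminal N =>
          have h1 : φ N = φ r.input := by simpa [renameSymbol] using hs
          have h2 : N ∈ S := hv N (by simp)
          rw [hφ h2 (hin r hr) h1]
      subst hs'
      refine ⟨x ++ r.output ++ y, by simp, ?_, hd.tail ⟨r, hr, ?_⟩⟩
      · intro N hN
        simp only [List.mem_append] at hN
        rcases hN with (hN | hN) | hN
        · exact hv N (by simp [hN])
        · exact hout r hr N hN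
        · exact hv N (by simp [hN])
      · simpa using ContextFreeRule.rewrites_of_exists_parts r x y
  ext w
  change G'.Derives [Symbol.nonterminal G'.initial] (w.map Symbol.terminal) ↔
    G.Derives [Symbol.nonterminal G.initial] (w.map Symbol.terminal)
  rw [hinit]
  constructor
  · intro h
    obtain ⟨v, hv, -, hd⟩ := bwd [Symbol.nonterminal G.initial] (w.map Symbol.terminal)
      (fun N hN => by
        have : N = G.initial := by simpa using hN
        exact this ▸ h0) h
    have : v = w.map Symbol.terminal := by
      clear hd h
      induction w generalizing v with
      | nil => simpa using hv.symm
      | cons a w ih =>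
        obtain ⟨s, y, rfl, hs, hy⟩ := List.map_eq_cons_iff.1 hv.symm
        rw [ih y hy.symm]
        cases s with
        | terminal a' =>
          have : a' = a := by simpa [renameSymbol] using hs
          simp [this]
        | nonterminal N => simp [renameSymbol] at hs
    exact this ▸ hd
  · intro h
    have := fwd _ _ h
    simpa [renameSymbol, Function.comp_def] using this

/-- The languages that are described by grammar codes are exactly the context-free languages. -/
theorem isContextFree_iff_exists_grammarCode (L : Language Letter) :
    L.IsContextFree ↔ ∃ g : GrammarCode, g.language = L := by
  classical
  refine ⟨?_, fun ⟨g, hg⟩ => ⟨g.toGrammar, hg⟩⟩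
  rintro ⟨G, rfl⟩
  let S : Set G.NT := {G.initial} ∪ ⋃ r ∈ (G.rules : Set (ContextFreeRule Letter G.NT)),
    ({r.input} ∪ {N | Symbol.nonterminal N ∈ r.output})
  have hS : S.Finite := by
    refine (Set.finite_singleton _).union
      (G.rules.finite_toSet.biUnion fun r _ => (Set.finite_singleton _).union ?_)
    refine (r.output.finite_toSet.preimage (f := Symbol.nonterminal) ?_).subset fun N hN => hN
    intro x _ y _ h
    exact Symbol.nonterminal.inj h
  obtain ⟨φ, hφ⟩ : ∃ φ : G.NT → ℕ, Set.InjOn φ S := Set.countable_iff_exists_injOn.1 hS.countable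
  let c : Symbol Letter G.NT → ℕ ⊕ Letter := fun s =>
    match s with
    | Symbol.nonterminal N => Sum.inl (φ N)
    | Symbol.terminal a => Sum.inr a
  have hc : ∀ s, decodeSymbol (c s) = renameSymbol φ s := fun s => by cases s <;> rfl
  let g : GrammarCode := (φ G.initial, G.rules.toList.map fun r => (φ r.input, r.output.map c))
  have hmem : ∀ r' : ContextFreeRule Letter ℕ,
      (r' ∈ g.2.map fun r => (⟨r.1, r.2.map decodeSymbol⟩ : ContextFreeRule Letter ℕ)) ↔
        ∃ r ∈ G.rules, r' = ⟨φ r.input, r.output.map (renameSymbol φ)⟩ := by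
    intro r'
    simp only [g, List.map_map, List.mem_map, Finset.mem_toList, Function.comp_def, hc]
    constructor
    · rintro ⟨r, hr, rfl⟩
      exact ⟨r, hr, rfl⟩
    · rintro ⟨r, hr, rfl⟩
      exact ⟨r, hr, rfl⟩
  have hin : ∀ r ∈ G.rules, r.input ∈ S := fun r hr =>
    Or.inr (Set.mem_biUnion (x := r) hr (Or.inl rfl))
  have hout : ∀ r ∈ G.rules, ∀ N, Symbol.nonterminal N ∈ r.output → N ∈ S := fun r hr N hN =>
    Or.inr (Set.mem_biUnion (x := r) hr (Or.inr hN))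
  have h0 : G.initial ∈ S := Or.inl rfl
  have hrules : ∀ r' : ContextFreeRule Letter g.toGrammar.NT, r' ∈ g.toGrammar.rules ↔
      ∃ r ∈ G.rules, r' = ⟨φ r.input, r.output.map (renameSymbol φ)⟩ := by
    intro r'
    exact (g.mem_rules r').trans (hmem r')
  exact ⟨g, language_eq_of_rename G g.toGrammar φ S hφ h0 rfl hin hout hrules⟩

/-- Every automaton code describes a regular language, and every regular language has a code. -/
theorem isRegular_iff_exists_nfaCode (L : Language Letter) :
    L.IsRegular ↔ ∃ M : NFACode, M.language = L := by
  classical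
  constructor
  · rintro ⟨σ, _, D, rfl⟩
    let e := Fintype.equivFin σ
    let M : NFACode := (Fintype.card σ,
      (Finset.univ : Finset (σ × Letter)).toList.map
        (fun q => ((e q.1 : ℕ), q.2, (e (D.step q.1 q.2) : ℕ))),
      [(e D.start : ℕ)], (Finset.univ.filter (· ∈ D.accept)).toList.map fun q => (e q : ℕ))
    have hstep : ∀ (w : List Letter) (s : σ),
        M.toNFA.evalFrom {e s} w = {e (D.evalFrom s w)} := by
      intro w
      induction w with
      | nil => intro s; simp
      | cons a w ih =>
        intro s
        have : M.toNFA.step (e s) a = {e (D.step s a)} := by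
          ext q
          simp only [NFACode.toNFA, M, Set.mem_ofPred_eq, List.mem_map, Finset.mem_toList,
            Finset.mem_univ, true_and, Prod.mk.injEq, Prod.exists, Set.mem_singleton_iff]
          constructor
          · rintro ⟨s', a', h1, rfl, h2⟩
            have : s' = s := e.injective (Fin.ext h1)
            subst this
            exact (Fin.ext h2).symm
          · rintro rfl
            exact ⟨s, a, rfl, rfl, rfl⟩
        rw [NFA.evalFrom_cons, NFA.stepSet_singleton, this, ih]
        rfl
    refine ⟨M, ?_⟩
    have hstart : M.toNFA.start = {e D.start} := by
      ext q
      simp [NFACode.toNFA, M, Fin.ext_iff]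
    ext w
    change (∃ q ∈ M.toNFA.accept, q ∈ M.toNFA.evalFrom M.toNFA.start w) ↔
      D.evalFrom D.start w ∈ D.accept
    rw [hstart, hstep]
    simp only [Set.mem_singleton_iff, exists_eq_right]
    simp only [NFACode.toNFA, M, Set.mem_ofPred_eq, List.mem_map, Finset.mem_toList,
      Finset.mem_filter, Finset.mem_univ, true_and]
    constructor
    · rintro ⟨s, hs, h⟩
      have : s = D.evalFrom D.start w := e.injective (Fin.ext h)
      exact this ▸ hs
    · intro h
      exact ⟨_, h, rfl⟩
  · rintro ⟨M, rfl⟩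
    exact ⟨Set (Fin M.1), inferInstance, M.toNFA.toDFA, NFA.toDFA_correct⟩

/-! Every word of `𝔾` is a concatenation of codes in exactly one way, and its graph depends only on
the set of these codes, not on their order or multiplicity (`wordGraph_eq`). By torsion, an exponent
of `b` may be exchanged for any other one with the same value of `torsionReduce`, so membership in
`L` depends only on the list of reduced codes (`flatMap_mem_iff_of_map_eq`). There are finitely many
reduced codes, and a finite transducer outputs them.

Let `B` be `pumpBound`, and equip the transducer with a memory that counts each output up to `B +
1`. Let `R` consist of the words `w` leading this machine to the same state as some `w₁ ∈ L`.
Clearly `L ⊆ R`, so every graph of `L` is a graph of `R`. Conversely, if a reduced code is output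
more often for `w` than for `w₁`, then it is output more than `B` times for `w₁`. A derivation tree
of `w₁` then repeats a triple (nonterminal, state before, state after) on some path, with this code
among the outputs in between, and can be pumped without losing an output or creating a new kind of
output (`Run.count_le_or_pump`, `exists_yields_le_outputs`).

The result is a word `w₂ ∈ L` with the same kinds of reduced codes as `w`, each at least as often.
Its exponents can be changed within their classes so that its codes become exactly those of `w`, the
surplus positions repeating some of them (`exists_map_eq_of_subperm`). By torsion the changed word
is still in `L`, and it has the graph of `w` (`exists_wordGraph_eq`).

`R` is accepted by a deterministic automaton whose accepting states are those reached by words of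
`L`. They are computed by saturating the set of triples (state, nonterminal, state) under the rules
(`exists_computable_nfaCode`). -/

/-! ### Derivations of context-free grammars as trees -/

/-- The word `w` is derived from a sentential form. -/
inductive Yields (rules : List (ℕ × List (ℕ ⊕ Letter))) :
    List (ℕ ⊕ Letter) → List Letter → Prop
  | nil : Yields rules [] []
  | terminal (c : Letter) {α : List (ℕ ⊕ Letter)} {w : List Letter} :
      Yields rules α w → Yields rules (Sum.inr c :: α) (c :: w)
  | nonterminal {A : ℕ} {β α : List (ℕ ⊕ Letter)} {u v : List Letter} :
      (A, β) ∈ rules → Yields rules β u → Yields rules α v →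
      Yields rules (Sum.inl A :: α) (u ++ v)

namespace Yields

variable {rules : List (ℕ × List (ℕ ⊕ Letter))}

theorem append {α β : List (ℕ ⊕ Letter)} {u v : List Letter} (hα : Yields rules α u)
    (hβ : Yields rules β v) : Yields rules (α ++ β) (u ++ v) := by
  induction hα with
  | nil => exact hβ
  | terminal c _ ih => exact ih.terminal c
  | nonterminal hr h1 _ _ ih => simpa using nonterminal hr h1 ih

theorem exists_of_append {α β : List (ℕ ⊕ Letter)} {w : List Letter}
    (h : Yields rules (α ++ β) w) :
    ∃ u v, w = u ++ v ∧ Yields rules α u ∧ Yields rules β v := by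
  induction α generalizing w with
  | nil => exact ⟨[], w, rfl, nil, h⟩
  | cons s α ih =>
    cases h with
    | terminal c h =>
      obtain ⟨u, v, rfl, h1, h2⟩ := ih h
      exact ⟨c :: u, v, rfl, h1.terminal c, h2⟩
    | nonterminal hr h1 h =>
      obtain ⟨u, v, rfl, h2, h3⟩ := ih h
      exact ⟨_, v, (List.append_assoc _ _ _).symm, nonterminal hr h1 h2, h3⟩

theorem map_inr (w : List Letter) : Yields rules (w.map Sum.inr) w := by
  induction w with
  | nil => exact nil
  | cons c w ih => exact ih.terminal c

end Yields

theorem decodeSymbol_injective : Function.Injective decodeSymbol := by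
  rintro (x | x) (y | y) h <;> simp_all [decodeSymbol]

/-- The derivation is read from its end: undoing one rewriting step cuts the word derived from `x β
y` into three pieces and hangs the middle one below the rewritten nonterminal. -/
theorem GrammarCode.yields_of_derives (g : GrammarCode) (w : List Letter)
    (u : List (Symbol Letter ℕ)) (h : g.toGrammar.Derives u (w.map Symbol.terminal))
    (α : List (ℕ ⊕ Letter)) (hα : α.map decodeSymbol = u) : Yields g.2 α w := by
  induction h using Relation.ReflTransGen.head_induction_on generalizing α with
  | refl =>
    have : α = w.map Sum.inr := by
      apply List.map_injective_iff.2 decodeSymbol_injective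
      rw [hα, List.map_map]
      rfl
    exact this ▸ Yields.map_inr w
  | head h _ ih =>
    obtain ⟨r, hr, h⟩ := h
    obtain ⟨x, y, rfl, rfl⟩ := h.exists_parts
    obtain ⟨⟨A, β⟩, hA, rfl⟩ := List.mem_map.1 ((g.mem_rules r).1 hr)
    obtain ⟨αx, αy, rfl, hx, rfl⟩ := List.map_eq_append_iff.1 hα
    obtain ⟨αx, αA, rfl, rfl, hA'⟩ := List.map_eq_append_iff.1 hx
    have : αA = [Sum.inl A] :=
      List.map_injective_iff.2 decodeSymbol_injective (hA'.trans rfl)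
    subst this
    obtain ⟨u1, u2, rfl, h1, h2⟩ :=
      Yields.exists_of_append (ih (αx ++ β ++ αy) (by rw [List.map_append, List.map_append]; rfl))
    obtain ⟨u0, u1, rfl, h0, h1⟩ := Yields.exists_of_append h1
    have := h0.append ((Yields.nonterminal hA h1 Yields.nil).append h2)
    simpa using this

theorem GrammarCode.derives_of_yields (g : GrammarCode) {α : List (ℕ ⊕ Letter)}
    {w : List Letter} (h : Yields g.2 α w) :
    g.toGrammar.Derives (α.map decodeSymbol) (w.map Symbol.terminal) := by
  induction h with
  | nil => exact Relation.ReflTransGen.refl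
  | terminal c _ ih => exact ih.append_left [Symbol.terminal c]
  | @nonterminal A β α u v hr _ _ ih1 ih2 =>
    have hp : g.toGrammar.Produces [Symbol.nonterminal A] (β.map decodeSymbol) :=
      ⟨⟨A, β.map decodeSymbol⟩, (g.mem_rules _).2 (List.mem_map.2 ⟨_, hr, rfl⟩),
        ContextFreeRule.Rewrites.input_output⟩
    have h1 := (hp.single.trans ih1).append_right (α.map decodeSymbol)
    have h2 := ih2.append_left (u.map Symbol.terminal)
    rw [List.map_append]
    exact h1.trans h2

theorem GrammarCode.mem_language_iff (g : GrammarCode) (w : List Letter) :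
    w ∈ g.language ↔ Yields g.2 [Sum.inl g.1] w :=
  ⟨fun h => g.yields_of_derives w _ h _ rfl, fun h => g.derives_of_yields h⟩

/-! ### Derivations seen through a transducer -/

/-- The outputs of a transducer along a word. -/
def outputs {σ Γ : Type} (δ : σ → Letter → σ) (em : σ → Letter → Option Γ) :
    σ → List Letter → List Γ
  | _, [] => []
  | s, c :: w => (em s c).toList ++ outputs δ em (δ s c) w

theorem outputs_append {σ Γ : Type} (δ : σ → Letter → σ) (em : σ → Letter → Option Γ) (s : σ)
    (u v : List Letter) :
    outputs δ em s (u ++ v) = outputs δ em s u ++ outputs δ em (u.foldl δ s) v := by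
  induction u generalizing s with
  | nil => rfl
  | cons c u ih => simp [outputs, ih]

/-- A derivation from a sentential form, together with the states of a transducer before and after
the derived word, and the multiset of the outputs. All nonterminals that are
replaced belong to `F`, together with the states before and after the word derived from them. -/
inductive Run {σ Γ : Type} (rules : List (ℕ × List (ℕ ⊕ Letter))) (δ : σ → Letter → σ)
    (em : σ → Letter → Option Γ) (F : Set (ℕ × σ × σ)) :
    σ → List (ℕ ⊕ Letter) → σ → Multiset Γ → Prop
  | nil (s : σ) : Run rules δ em F s [] s 0
  | terminal {s s' : σ} (c : Letter) {α : List (ℕ ⊕ Letter)} {o : Multiset Γ} :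
      Run rules δ em F (δ s c) α s' o →
      Run rules δ em F s (Sum.inr c :: α) s' (((em s c).toList : Multiset Γ) + o)
  | nonterminal {s s₁ s' : σ} {A : ℕ} {β α : List (ℕ ⊕ Letter)} {o₁ o₂ : Multiset Γ} :
      (A, s, s₁) ∈ F → (A, β) ∈ rules → Run rules δ em F s β s₁ o₁ →
      Run rules δ em F s₁ α s' o₂ → Run rules δ em F s (Sum.inl A :: α) s' (o₁ + o₂)

namespace Run

variable {σ Γ : Type} {rules : List (ℕ × List (ℕ ⊕ Letter))} {δ : σ → Letter → σ}
  {em : σ → Letter → Option Γ}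

theorem mono {F F' : Set (ℕ × σ × σ)} (hF : F ⊆ F') {s s' : σ} {α : List (ℕ ⊕ Letter)}
    {o : Multiset Γ} (h : Run rules δ em F s α s' o) : Run rules δ em F' s α s' o := by
  induction h with
  | nil s => exact nil s
  | terminal c _ ih => exact ih.terminal c
  | nonterminal hA hr _ _ ih1 ih2 => exact nonterminal (hF hA) hr ih1 ih2

theorem exists_word {F : Set (ℕ × σ × σ)} {s s' : σ} {α : List (ℕ ⊕ Letter)} {o : Multiset Γ}
    (h : Run rules δ em F s α s' o) :
    ∃ w, Yields rules α w ∧ w.foldl δ s = s' ∧ (outputs δ em s w : Multiset Γ) = o := by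
  induction h with
  | nil s => exact ⟨[], Yields.nil, rfl, rfl⟩
  | terminal c _ ih =>
    obtain ⟨w, h1, h2, rfl⟩ := ih
    exact ⟨c :: w, h1.terminal c, h2, rfl⟩
  | nonterminal hA hr _ _ ih1 ih2 =>
    obtain ⟨u, h1, rfl, rfl⟩ := ih1
    obtain ⟨v, h3, rfl, rfl⟩ := ih2
    exact ⟨u ++ v, Yields.nonterminal hr h1 h3, List.foldl_append, by
      rw [outputs_append, Multiset.coe_add]⟩

/-- Since `S` is closed under transitions, only triples over rule heads and `S` occur. When `S` is
finite this supplies the finite set on which the pumping argument inducts. -/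
theorem of_yields {S : Set σ} (hS : ∀ s ∈ S, ∀ c, δ s c ∈ S) {α : List (ℕ ⊕ Letter)}
    {w : List Letter} (h : Yields rules α w) (s : σ) (hs : s ∈ S) :
    w.foldl δ s ∈ S ∧ Run rules δ em ({A | A ∈ rules.map Prod.fst} ×ˢ (S ×ˢ S)) s α
      (w.foldl δ s) (outputs δ em s w) := by
  induction h generalizing s with
  | nil => exact ⟨hs, nil s⟩
  | terminal c _ ih =>
    obtain ⟨h1, h2⟩ := ih (δ s c) (hS s hs c)
    exact ⟨h1, h2.terminal c⟩
  | @nonterminal A β α u v hr _ _ ih1 ih2 =>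
    obtain ⟨h1, h2⟩ := ih1 s hs
    obtain ⟨h3, h4⟩ := ih2 _ h1
    rw [List.foldl_append, outputs_append, ← Multiset.coe_add]
    exact ⟨h3, nonterminal ⟨List.mem_map.2 ⟨_, hr, rfl⟩, hs, h1⟩ hr h2 h4⟩

/-- Either `a` does not occur in a derivation, or there is an innermost occurrence. -/
theorem exists_innermost {F : Set (ℕ × σ × σ)} {s s' : σ} {α : List (ℕ ⊕ Letter)}
    {o : Multiset Γ} (h : Run rules δ em F s α s' o) (A : ℕ) (q q' : σ) :
    Run rules δ em (F \ {(A, q, q')}) s α s' o ∨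
    ∃ β c o₀, (A, β) ∈ rules ∧ Run rules δ em (F \ {(A, q, q')}) q β q' o₀ ∧ o = c + o₀ ∧
      ∀ β' o', (A, β') ∈ rules → Run rules δ em Set.univ q β' q' o' →
        Run rules δ em Set.univ s α s' (c + o') := by
  induction h with
  | nil s => exact Or.inl (nil s)
  | terminal c _ ih =>
    rcases ih with h | ⟨β, d, o₀, hr, h, rfl, hc⟩
    · exact Or.inl (h.terminal c)
    · refine Or.inr ⟨β, _ + d, o₀, hr, h, (add_assoc _ _ _).symm, fun β' o' hr' h' => ?_⟩
      rw [add_assoc]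
      exact (hc β' o' hr' h').terminal c
  | @nonterminal s s₁ s' B β α o₁ o₂ hB hr h1 h2 ih1 ih2 =>
    rcases ih1 with h1' | ⟨β', d, o₀, hr', h, rfl, hc⟩
    · rcases ih2 with h2' | ⟨β', d, o₀, hr', h, rfl, hc⟩
      -- No occurrence lies strictly below or to the right, so the present node is innermost if it
      -- carries the triple at all; its context then outputs only `o₂`.
      · by_cases hq : (B, s, s₁) = (A, q, q')
        · cases hq
          refine Or.inr ⟨β, o₂, o₁, hr, h1', add_comm _ _, fun β' o' hr' h' => ?_⟩
          rw [add_comm]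
          exact nonterminal trivial hr' h' (h2.mono (Set.subset_univ _))
        · exact Or.inl (nonterminal ⟨hB, hq⟩ hr h1' h2')
      · refine Or.inr ⟨β', o₁ + d, o₀, hr', h, (add_assoc _ _ _).symm, fun β' o' hr' h' => ?_⟩
        rw [add_assoc]
        exact nonterminal trivial hr (h1.mono (Set.subset_univ _)) (hc β' o' hr' h')
    · refine Or.inr ⟨β', d + o₂, o₀, hr', h, by abel, fun β' o' hr' h' => ?_⟩
      rw [add_right_comm]
      exact nonterminal trivial hr (hc β' o' hr' h') (h2.mono (Set.subset_univ _))

/-- A derivation in which a letter occurs often can be replaced by one in which it occurs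
more often, and no other letter occurs less often, or newly. -/
theorem count_le_or_pump [DecidableEq Γ] {m : ℕ} (hm : 1 ≤ m)
    (hrules : ∀ r ∈ rules, r.2.length ≤ m) (x : Γ) (k : ℕ) :
    ∀ (F : Set (ℕ × σ × σ)), F.Finite → F.ncard ≤ k → ∀ {s s' : σ} {α : List (ℕ ⊕ Letter)}
      {o : Multiset Γ}, Run rules δ em F s α s' o → o.count x ≤ α.length * m ^ k ∨
      ∃ o', Run rules δ em Set.univ s α s' o' ∧ o ≤ o' ∧ o' ⊆ o ∧ o.count x < o'.count x := by
  induction k with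
  | zero =>
    intro F hF hk s s' α o h
    -- No nonterminal can be replaced, so the form is terminal and each letter outputs at most one
    -- symbol.
    have hF0 : F = ∅ := (Set.ncard_eq_zero hF).1 (Nat.le_zero.1 hk)
    left
    induction h with
    | nil s => simp
    | @terminal s s' c α o _ ih =>
      have : (em s c).toList.count x ≤ 1 :=
        List.count_le_length.trans (by cases em s c <;> simp)
      simp only [Multiset.count_add, Multiset.coe_count, List.length_cons]
      lia
    | nonterminal hA => simp [hF0] at hA
  | succ k ih =>
    intro F hF hk s s' α o h
    have hpos : 1 ≤ m ^ (k + 1) := Nat.one_le_pow _ _ hm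
    induction h with
    | nil s => simp
    | @terminal s s' c α o _ ih' =>
      rcases ih' with h | ⟨o', h, h1, h2, h3⟩
      · left
        have : (em s c).toList.count x ≤ 1 :=
          List.count_le_length.trans (by cases em s c <;> simp)
        simp only [Multiset.count_add, Multiset.coe_count, List.length_cons, add_mul, one_mul]
        lia
      · right
        refine ⟨_, h.terminal c, by gcongr, ?_, by simpa using h3⟩
        intro y hy
        rw [Multiset.mem_add] at hy ⊢
        exact hy.imp_right fun hy => h2 hy
    | @nonterminal s s₁ s' A β α o₁ o₂ hA hr h1 h2 _ ih2 =>
      have hF' : (F \ {(A, s, s₁)}).ncard ≤ k := by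
        rw [Set.ncard_sdiff_singleton_of_mem hA]
        lia
      -- The tree below a single nonterminal is bounded or pumped first. Removing its triple from
      -- `F` makes the hypothesis for `k` available.
      have key : o₁.count x ≤ m ^ (k + 1) ∨ ∃ β' o', (A, β') ∈ rules ∧
          Run rules δ em Set.univ s β' s₁ o' ∧ o₁ ≤ o' ∧ o' ⊆ o₁ ∧
          o₁.count x < o'.count x := by
        have bound : ∀ β, (A, β) ∈ rules → β.length * m ^ k ≤ m ^ (k + 1) := fun β hβ => by
          rw [pow_succ']
          exact Nat.mul_le_mul_right _ (hrules _ hβ)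
        rcases h1.exists_innermost A s s₁ with h | ⟨β', c, o₀, hr', h, rfl, hc⟩
        · rcases ih _ (hF.subset Set.sdiff_subset) hF' h with h | ⟨o', h⟩
          · exact Or.inl (h.trans (bound _ hr))
          · exact Or.inr ⟨β, o', hr, h⟩
        -- Here `c` is the output of the context between the root and the innermost repetition of
        -- its triple. If `x` is absent from `c`, all its occurrences lie in the inner tree, to
        -- which the hypothesis for `k` applies; otherwise inserting the context a second time adds
        -- occurrences of `x` and no new symbols.
        · by_cases hcx : c.count x = 0
          · rcases ih _ (hF.subset Set.sdiff_subset) hF' h with h | ⟨o', h, ho1, ho2, ho3⟩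
            · left
              rw [Multiset.count_add, hcx, zero_add]
              exact h.trans (bound _ hr')
            · right
              refine ⟨β, c + o', hr, hc _ _ hr' h, by gcongr, ?_, by simpa using ho3⟩
              intro y hy
              rw [Multiset.mem_add] at hy ⊢
              exact hy.imp_right fun hy => ho2 hy
          · right
            refine ⟨β, c + (c + o₀), hr, hc _ _ hr (hc _ _ hr' (h.mono (Set.subset_univ _))),
              Multiset.le_add_left _ _, ?_, ?_⟩
            · intro y hy
              simp only [Multiset.mem_add] at hy ⊢
              tauto
            · simp only [Multiset.count_add]
              lia
      rcases key with key | ⟨β', o', hr', h, ho1, ho2, ho3⟩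
      · rcases ih2 with h | ⟨o', h, ho1, ho2, ho3⟩
        · left
          simp only [Multiset.count_add, List.length_cons, add_mul, one_mul]
          lia
        · right
          refine ⟨_, nonterminal trivial hr (h1.mono (Set.subset_univ _)) h, by gcongr, ?_,
            by simpa using ho3⟩
          intro y hy
          rw [Multiset.mem_add] at hy ⊢
          exact hy.imp_right fun hy => ho2 hy
      · right
        refine ⟨_, nonterminal trivial hr' h (h2.mono (Set.subset_univ _)), by gcongr, ?_,
          by simpa using ho3⟩
        intro y hy
        rw [Multiset.mem_add] at hy ⊢
        exact hy.imp_left fun hy => ho2 hy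

end Run

/-- Letters of the output that occur more than `m ^ k` times can be pumped, so that every multiset
which does not exceed the output at the other letters is covered. -/
theorem exists_yields_le_outputs {σ Γ : Type} [DecidableEq Γ]
    {rules : List (ℕ × List (ℕ ⊕ Letter))} {δ : σ → Letter → σ} {em : σ → Letter → Option Γ}
    {m k : ℕ} (hm : 1 ≤ m) (hrules : ∀ r ∈ rules, r.2.length ≤ m)
    {S : Set σ} (hSfin : S.Finite) (hS : ∀ s ∈ S, ∀ c, δ s c ∈ S)
    (hk : rules.length * (S.ncard * S.ncard) ≤ k) {A : ℕ} {s : σ} (hs : s ∈ S)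
    (X : Multiset Γ) {w : List Letter} (hw : Yields rules [Sum.inl A] w)
    (hX : ∀ x, (outputs δ em s w).count x < X.count x → m ^ k < (outputs δ em s w).count x) :
    ∃ w', Yields rules [Sum.inl A] w' ∧ w'.foldl δ s = w.foldl δ s ∧
      X ≤ outputs δ em s w' ∧ outputs δ em s w' ⊆ outputs δ em s w := by
  -- Each pumping step lowers the total deficit of the output relative to `X`, since no count drops
  -- and the count of a deficient symbol rises.
  induction hn : (X - (outputs δ em s w : Multiset Γ)).card using Nat.strong_induction_on
    generalizing w with
  | _ n ih =>
    by_cases hle : X ≤ (outputs δ em s w : Multiset Γ)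
    · exact ⟨w, hw, rfl, hle, fun _ h => h⟩
    · obtain ⟨x, hx⟩ : ∃ x, (outputs δ em s w).count x < X.count x := by
        simpa [Multiset.le_iff_count] using hle
      have hfin : ({A | A ∈ rules.map Prod.fst} : Set ℕ).Finite := List.finite_toSet _
      have hcard : (({A | A ∈ rules.map Prod.fst} : Set ℕ) ×ˢ (S ×ˢ S)).ncard ≤ k := by
        refine le_trans ?_ hk
        rw [Set.ncard_prod, Set.ncard_prod]
        refine Nat.mul_le_mul_right _ ?_
        have : ({A | A ∈ rules.map Prod.fst} : Set ℕ) =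
            ((rules.map Prod.fst).toFinset : Set ℕ) := by
          ext
          simp
        rw [this, Set.ncard_coe_finset]
        simpa using List.toFinset_card_le (rules.map Prod.fst)
      rcases Run.count_le_or_pump hm hrules x k _ (hfin.prod (hSfin.prod hSfin)) hcard
        (Run.of_yields (em := em) hS hw s hs).2 with h | ⟨o', h, h1, h2, h3⟩
      · have := hX x hx
        simp only [Multiset.coe_count, List.length_singleton, one_mul] at h
        lia
      · obtain ⟨w₁, hw₁, hst, rfl⟩ := h.exists_word
        have hcnt : ∀ y, (outputs δ em s w).count y ≤ (outputs δ em s w₁).count y := fun y => by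
          simpa using Multiset.le_iff_count.1 h1 y
        have hlt : (X - (outputs δ em s w₁ : Multiset Γ)).card < n := by
          rw [← hn]
          refine Multiset.card_lt_card (lt_of_le_of_ne (tsub_le_tsub_left h1 X) fun he => ?_)
          have := congrArg (Multiset.count x) he
          simp only [Multiset.count_sub, Multiset.coe_count] at this h3
          lia
        obtain ⟨w₂, hw₂, hst₂, hX₂, hsub⟩ := ih _ hlt hw₁
          (fun y hy => (hX y ((hcnt y).trans_lt hy)).trans_le (hcnt y)) rfl
        exact ⟨w₂, hw₂, hst₂.trans hst, hX₂, fun y hy => h2 (hsub hy)⟩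

/-! ### Computable closures -/

theorem primrecRel_list_subset {α : Type} [Primcodable α] :
    PrimrecRel fun l' l : List α => l' ⊆ l := by
  have hmem : PrimrecRel fun (l : List α) (x : α) => ∃ y ∈ l, y = x :=
    PrimrecRel.exists_mem_list Primrec.eq
  have hmem' : PrimrecRel fun (x : α) (l : List α) => x ∈ l := by
    refine PrimrecPred.of_eq (p := fun z : α × List α => ∃ y ∈ z.2, y = z.1)
      (hmem.comp Primrec.snd Primrec.fst) fun z => ?_
    simp
  exact PrimrecRel.of_eq (PrimrecRel.forall_mem_list hmem') fun l' l => Iff.rfl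

/-- If `step` computably enlarges lists within a finite set, then a closed list is computable. -/
theorem exists_computable_closure {P α : Type} [Primcodable P] [Primcodable α]
    (init : P → List α) (step : P → List α → List α) (hinit : Computable init)
    (hstep : Computable₂ step) (hsub : ∀ p l, l ⊆ step p l)
    (hfin : ∀ p, ∃ S : Set α, S.Finite ∧ (∀ x ∈ init p, x ∈ S) ∧
      ∀ l, (∀ x ∈ l, x ∈ S) → ∀ x ∈ step p l, x ∈ S) :
    ∃ cl : P → List α, Computable cl ∧ ∀ p, init p ⊆ cl p ∧ step p (cl p) ⊆ cl p ∧
      ∀ I : α → Prop, (∀ x ∈ init p, I x) →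
        (∀ l, (∀ x ∈ l, I x) → ∀ x ∈ step p l, I x) → ∀ x ∈ cl p, I x := by
  classical
  let it : P → ℕ → List α := fun p n => Nat.rec (init p) (fun _ l => step p l) n
  have hit : Computable₂ it := by
    refine (Computable.nat_rec (f := fun x : P × ℕ => x.2) (g := fun x : P × ℕ => init x.1)
      (h := fun (x : P × ℕ) (y : ℕ × List α) => step x.1 y.2) Computable.snd
      (hinit.comp Computable.fst) ?_)
    exact hstep.comp (Computable.fst.comp Computable.fst) (Computable.snd.comp Computable.snd)
  have hI : ∀ p n, ∀ I : α → Prop, (∀ x ∈ init p, I x) →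
      (∀ l, (∀ x ∈ l, I x) → ∀ x ∈ step p l, I x) → ∀ x ∈ it p n, I x := by
    intro p n I h0 h1
    induction n with
    | zero => exact h0
    | succ n ih => exact h1 _ ih
  have hstable : ∀ p, ∃ n, step p (it p n) ⊆ it p n := by
    intro p
    obtain ⟨S, hS, h0, h1⟩ := hfin p
    by_contra! hcon
    -- Without stabilization each iteration adds a new element, which is impossible inside a finite
    -- set. Hence the unbounded search for a stable iterate terminates.
    have hlt : ∀ n, n ≤ (it p n).toFinset.card := by
      intro n
      induction n with
      | zero => exact Nat.zero_le _
      | succ n ih =>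
        refine Nat.lt_of_le_of_lt ih (Finset.card_lt_card ?_)
        refine (Finset.ssubset_iff_subset_ne).2 ⟨?_, fun he => hcon n ?_⟩
        · intro x hx
          exact List.mem_toFinset.2 (hsub p _ (List.mem_toFinset.1 hx))
        · intro x hx
          exact List.mem_toFinset.1 (he ▸ List.mem_toFinset.2 hx)
    have hle : ∀ n, (it p n).toFinset.card ≤ hS.toFinset.card := fun n =>
      Finset.card_le_card fun x hx =>
        hS.mem_toFinset.2 (hI p n (· ∈ S) h0 h1 x (List.mem_toFinset.1 hx))
    have := (hlt (hS.toFinset.card + 1)).trans (hle (hS.toFinset.card + 1))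
    lia
  let D : DecidableRel fun l' l : List α => l' ⊆ l := fun _ _ => Classical.propDecidable _
  have hdec : ComputablePred fun x : P × ℕ => step x.1 (it x.1 x.2) ⊆ it x.1 x.2 :=
    ⟨fun _ => D _ _, (primrecRel_list_subset (α := α)).decide.to_comp.comp
      (hstep.comp Computable.fst hit) hit⟩
  let ix : P → ℕ := fun p => @Nat.find _ (fun _ => D _ _) (hstable p)
  have hix : Computable ix :=
    @Computable.find _ _ (fun p n => step p (it p n) ⊆ it p n) (fun _ _ => D _ _) hdec hstable
  have hinit' : ∀ p n, init p ⊆ it p n := by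
    intro p n
    induction n with
    | zero => exact fun _ h => h
    | succ n ih => exact fun x hx => hsub p _ (ih hx)
  refine ⟨fun p => it p (ix p), hit.comp Computable.id hix, fun p =>
    ⟨hinit' p _, ?_, hI p _⟩⟩
  exact @Nat.find_spec _ (fun _ => D _ _) (hstable p)

/-! ### Reachability in an automaton along derived words -/

/-- The states that are reached from the states in `l` along a sentential form, when `T` tells which
states are connected by a nonterminal. -/
def reachList {σ : Type} [DecidableEq σ] (δ : σ → Letter → σ) (T : List (σ × ℕ × σ))
    (α : List (ℕ ⊕ Letter)) (l : List σ) : List σ :=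
  α.foldl (fun l s => l.flatMap fun x =>
    Sum.casesOn s (fun A => T.flatMap fun e => if e.1 = x ∧ e.2.1 = A then [e.2.2] else [])
      (fun c => [δ x c])) l

/-- Soundness of the saturation: if each triple in `T` is witnessed by a derived word, concatenating
the witnesses along `α` gives a witness for the reached state. -/
theorem exists_of_mem_reachList {σ : Type} [DecidableEq σ] {δ : σ → Letter → σ}
    {T : List (σ × ℕ × σ)} {rules : List (ℕ × List (ℕ ⊕ Letter))}
    (hT : ∀ e ∈ T, ∃ w, Yields rules [Sum.inl e.2.1] w ∧ w.foldl δ e.1 = e.2.2)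
    (α : List (ℕ ⊕ Letter)) (l : List σ) {y : σ} (hy : y ∈ reachList δ T α l) :
    ∃ x ∈ l, ∃ w, Yields rules α w ∧ w.foldl δ x = y := by
  induction α generalizing l with
  | nil => exact ⟨y, hy, [], Yields.nil, rfl⟩
  | cons s α ih =>
    obtain ⟨z, hz, w, hw, rfl⟩ := ih _ hy
    obtain ⟨x, hx, hz⟩ := List.mem_flatMap.1 hz
    refine ⟨x, hx, ?_⟩
    cases s with
    | inl A =>
      obtain ⟨e, he, hze⟩ := List.mem_flatMap.1 hz
      split_ifs at hze with hc
      · obtain ⟨rfl, rfl⟩ := hc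
        obtain ⟨u, hu, hue⟩ := hT e he
        refine ⟨u ++ w, hu.append hw, ?_⟩
        rw [List.foldl_append, hue, List.mem_singleton.1 hze]
      · simp at hze
    | inr c =>
      refine ⟨c :: w, hw.terminal c, ?_⟩
      have hz : z = δ x c := List.mem_singleton.1 hz
      rw [hz]
      rfl

/-- Completeness of the saturation: when `T` is closed under the rules, induction on the derivation
puts the triple of every subtree into `T`. -/
theorem foldl_mem_reachList {σ : Type} [DecidableEq σ] {δ : σ → Letter → σ}
    {T : List (σ × ℕ × σ)} {rules : List (ℕ × List (ℕ ⊕ Letter))} {Q : List σ}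
    (hQ : ∀ x ∈ Q, ∀ c, δ x c ∈ Q)
    (hT : ∀ r ∈ rules, ∀ x ∈ Q, ∀ y ∈ reachList δ T r.2 [x], (x, r.1, y) ∈ T)
    {α : List (ℕ ⊕ Letter)} {w : List Letter} (h : Yields rules α w) (l : List σ) (x : σ)
    (hx : x ∈ l) (hxQ : x ∈ Q) : w.foldl δ x ∈ Q ∧ w.foldl δ x ∈ reachList δ T α l := by
  induction h generalizing l x with
  | nil => exact ⟨hxQ, hx⟩
  | terminal c _ ih =>
    exact ih _ (δ x c) (List.mem_flatMap.2 ⟨x, hx, List.mem_singleton_self _⟩) (hQ x hxQ c)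
  | @nonterminal A β α u v hr _ _ ih1 ih2 =>
    obtain ⟨h1, h2⟩ := ih1 [x] x (List.mem_singleton_self _) hxQ
    have h3 := hT _ hr x hxQ _ h2
    rw [List.foldl_append]
    refine ih2 _ (u.foldl δ x) (List.mem_flatMap.2 ⟨x, hx, List.mem_flatMap.2 ⟨_, h3, ?_⟩⟩) h1
    simp

/-- The code of a deterministic automaton with the list `Q` of states. -/
def automatonCode {σ : Type} [DecidableEq σ] (δ : σ → Letter → σ) (start : σ) (Q acc : List σ) :
    NFACode :=
  (Q.length, Q.flatMap (fun x => [(Q.idxOf x, letterA, Q.idxOf (δ x letterA)),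
    (Q.idxOf x, letterB, Q.idxOf (δ x letterB))]), [Q.idxOf start], acc.map Q.idxOf)

/-- A state is named by its first position in `Q`. This is injective on `Q`, so each evaluation
stays a singleton; repeated entries of `Q` only yield unused state numbers. -/
theorem mem_automatonCode_language {σ : Type} [DecidableEq σ] {δ : σ → Letter → σ} {start : σ}
    {Q acc : List σ} (hQ : ∀ x ∈ Q, ∀ c, δ x c ∈ Q) (hstart : start ∈ Q) (hacc : acc ⊆ Q)
    (w : List Letter) :
    w ∈ (automatonCode δ start Q acc).language ↔ w.foldl δ start ∈ acc := by
  obtain ⟨M, hM⟩ : ∃ M, M = automatonCode δ start Q acc := ⟨_, rfl⟩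
  have hM0 : M.1 = Q.length := congrArg Prod.fst hM
  have hM1 : ∀ i c j, (i, c, j) ∈ M.2.1 ↔ ∃ x ∈ Q, i = Q.idxOf x ∧ j = Q.idxOf (δ x c) := by
    intro i c j
    rw [hM]
    simp only [automatonCode, List.mem_flatMap, List.mem_cons, Prod.mk.injEq, List.not_mem_nil,
      or_false]
    refine exists_congr fun x => and_congr_right fun _ => ?_
    cases c <;> simp
  have hM2 : M.2.2.1 = [Q.idxOf start] := by rw [hM]; rfl
  have hM3 : M.2.2.2 = acc.map Q.idxOf := by rw [hM]; rfl
  rw [← hM]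
  have hlt : ∀ {x}, x ∈ Q → Q.idxOf x < M.1 := fun hx => hM0 ▸ List.idxOf_lt_length_iff.2 hx
  have hfold : ∀ (w : List Letter) (x : σ), x ∈ Q → w.foldl δ x ∈ Q := by
    intro w
    induction w with
    | nil => exact fun x hx => hx
    | cons c w ih => exact fun x hx => ih _ (hQ x hx c)
  have hstep : ∀ (w : List Letter) (x : σ) (hx : x ∈ Q),
      M.toNFA.evalFrom {⟨Q.idxOf x, hlt hx⟩} w =
        {⟨Q.idxOf (w.foldl δ x), hlt (hfold w x hx)⟩} := by
    intro w
    induction w with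
    | nil => intro x hx; simp
    | cons c w ih =>
      intro x hx
      have : M.toNFA.step ⟨Q.idxOf x, hlt hx⟩ c =
          {⟨Q.idxOf (δ x c), hlt (hQ x hx c)⟩} := by
        ext q
        refine (hM1 _ c q).trans (Iff.trans ?_ Fin.ext_iff.symm)
        constructor
        · rintro ⟨y, hy, h1, h2⟩
          have : x = y := (List.idxOf_inj hx).1 h1
          subst this
          exact h2
        · exact fun h => ⟨x, hx, rfl, h⟩
      rw [NFA.evalFrom_cons, NFA.stepSet_singleton, this, ih _ (hQ x hx c)]
      rfl
  have hs : M.toNFA.start = {⟨Q.idxOf start, hlt hstart⟩} := by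
    ext q
    rw [Set.mem_singleton_iff, Fin.ext_iff]
    change (q : ℕ) ∈ M.2.2.1 ↔ (q : ℕ) = Q.idxOf start
    rw [hM2, List.mem_singleton]
  change (∃ q ∈ M.toNFA.accept, q ∈ M.toNFA.evalFrom M.toNFA.start w) ↔ _
  rw [hs, hstep w start hstart]
  simp only [Set.mem_singleton_iff, exists_eq_right]
  change Q.idxOf (w.foldl δ start) ∈ M.2.2.2 ↔ _
  rw [hM3, List.mem_map]
  constructor
  · rintro ⟨x, hx, h⟩
    rwa [← (List.idxOf_inj (hacc hx)).1 h]
  · exact fun h => ⟨_, h, rfl⟩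

theorem primrec_reachList {P σ : Type} [Primcodable P] [Primcodable σ] [DecidableEq σ]
    {δ : P → σ → Letter → σ} (hδ : Primrec fun x : P × σ × Letter => δ x.1 x.2.1 x.2.2)
    {T : P → List (σ × ℕ × σ)} (hT : Primrec T) {α : P → List (ℕ ⊕ Letter)} (hα : Primrec α)
    {l : P → List σ} (hl : Primrec l) :
    Primrec fun p => reachList (δ p) (T p) (α p) (l p) := by
  have hT' : Primrec₂ fun (z : (P × List σ × (ℕ ⊕ Letter)) × σ) (A : ℕ) =>
      (T z.1.1).flatMap fun e => if e.1 = z.2 ∧ e.2.1 = A then [e.2.2] else [] := by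
    refine Primrec.list_flatMap (f := fun z : ((P × List σ × (ℕ ⊕ Letter)) × σ) × ℕ => T z.1.1.1)
      (hT.comp (Primrec.fst.comp (Primrec.fst.comp Primrec.fst))) ?_
    refine Primrec.ite (PrimrecPred.and ?_ ?_) ?_ (Primrec.const [])
    · exact Primrec.eq.comp (Primrec.fst.comp Primrec.snd)
        (Primrec.snd.comp (Primrec.fst.comp Primrec.fst))
    · exact Primrec.eq.comp (Primrec.fst.comp (Primrec.snd.comp Primrec.snd))
        (Primrec.snd.comp Primrec.fst)
    · exact Primrec.list_cons.comp (Primrec.snd.comp (Primrec.snd.comp Primrec.snd))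
        (Primrec.const [])
  have hδ' : Primrec₂ fun (z : (P × List σ × (ℕ ⊕ Letter)) × σ) (c : Letter) =>
      [δ z.1.1 z.2 c] := by
    refine Primrec.list_cons.comp (hδ.comp (Primrec.pair ?_ (Primrec.pair ?_ Primrec.snd)))
      (Primrec.const [])
    · exact Primrec.fst.comp (Primrec.fst.comp Primrec.fst)
    · exact Primrec.snd.comp Primrec.fst
  have hstep : Primrec₂ fun (p : P) (z : List σ × (ℕ ⊕ Letter)) => z.1.flatMap fun x =>
      (Sum.casesOn z.2
        (fun A => (T p).flatMap fun e => if e.1 = x ∧ e.2.1 = A then [e.2.2] else [])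
        (fun c => [δ p x c]) : List σ) := by
    refine Primrec.list_flatMap (Primrec.fst.comp Primrec.snd) ?_
    exact Primrec.sumCasesOn (Primrec.snd.comp (Primrec.snd.comp Primrec.fst)) hT' hδ'
  exact Primrec.list_foldl hα hl hstep

/-- The triples of two states and a nonterminal connecting them that follow from given ones by one
rule. -/
def saturate {σ : Type} [DecidableEq σ] (δ : σ → Letter → σ)
    (rules : List (ℕ × List (ℕ ⊕ Letter))) (Q : List σ) (T : List (σ × ℕ × σ)) :
    List (σ × ℕ × σ) :=
  T ++ rules.flatMap fun r => Q.flatMap fun x =>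
    (reachList δ T r.2 [x]).map fun y => (x, r.1, y)

theorem mem_saturate {σ : Type} [DecidableEq σ] {δ : σ → Letter → σ}
    {rules : List (ℕ × List (ℕ ⊕ Letter))} {Q : List σ} {T : List (σ × ℕ × σ)}
    {e : σ × ℕ × σ} :
    e ∈ saturate δ rules Q T ↔ e ∈ T ∨ ∃ r ∈ rules, ∃ x ∈ Q,
      ∃ y ∈ reachList δ T r.2 [x], (x, r.1, y) = e := by
  simp only [saturate, List.mem_append, List.mem_flatMap, List.mem_map]

theorem subset_saturate {σ : Type} [DecidableEq σ] {δ : σ → Letter → σ}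
    {rules : List (ℕ × List (ℕ ⊕ Letter))} {Q : List σ} {T : List (σ × ℕ × σ)} :
    T ⊆ saturate δ rules Q T :=
  fun _ h => mem_saturate.2 (Or.inl h)

theorem primrec_saturate {P σ : Type} [Primcodable P] [Primcodable σ] [DecidableEq σ]
    {δ : P → σ → Letter → σ} (hδ : Primrec fun x : P × σ × Letter => δ x.1 x.2.1 x.2.2)
    {rules : P → List (ℕ × List (ℕ ⊕ Letter))} (hrules : Primrec rules)
    {Q : P → List σ} (hQ : Primrec Q) {T : P → List (σ × ℕ × σ)} (hT : Primrec T) :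
    Primrec fun p => saturate (δ p) (rules p) (Q p) (T p) := by
  have h1 : Primrec fun z : (P × (ℕ × List (ℕ ⊕ Letter))) × σ =>
      reachList (δ z.1.1) (T z.1.1) z.1.2.2 [z.2] := by
    refine primrec_reachList (P := (P × (ℕ × List (ℕ ⊕ Letter))) × σ)
      (δ := fun z => δ z.1.1) ?_ ?_ ?_ ?_
    · exact hδ.comp (Primrec.pair (Primrec.fst.comp (Primrec.fst.comp Primrec.fst)) Primrec.snd)
    · exact hT.comp (Primrec.fst.comp Primrec.fst)
    · exact Primrec.snd.comp (Primrec.snd.comp Primrec.fst)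
    · exact Primrec.list_cons.comp Primrec.snd (Primrec.const [])
  have h2 : Primrec₂ fun (z : P × (ℕ × List (ℕ ⊕ Letter))) (x : σ) =>
      (reachList (δ z.1) (T z.1) z.2.2 [x]).map fun y => (x, z.2.1, y) := by
    refine Primrec.list_map h1 (Primrec.pair (Primrec.snd.comp Primrec.fst)
      (Primrec.pair ?_ Primrec.snd))
    exact Primrec.fst.comp (Primrec.snd.comp (Primrec.fst.comp Primrec.fst))
  have h3 : Primrec₂ fun (p : P) (r : ℕ × List (ℕ ⊕ Letter)) => (Q p).flatMap fun x =>
      (reachList (δ p) (T p) r.2 [x]).map fun y => (x, r.1, y) :=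
    Primrec.list_flatMap (hQ.comp Primrec.fst) h2
  exact Primrec.list_append.comp hT (Primrec.list_flatMap hrules h3)

theorem computable_automatonCode {P σ : Type} [Primcodable P] [Primcodable σ] [DecidableEq σ]
    {δ : P → σ → Letter → σ} (hδ : Primrec fun x : P × σ × Letter => δ x.1 x.2.1 x.2.2)
    {start : P → σ} (hstart : Primrec start) {Q acc : P → List σ} (hQ : Computable Q)
    (hacc : Computable acc) :
    Computable fun p => automatonCode (δ p) (start p) (Q p) (acc p) := by
  have hidx : ∀ {β : Type} [Primcodable β] {f : β → σ} {g : β → List σ}, Primrec f → Primrec g →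
      Primrec fun b => (g b).idxOf (f b) := fun hf hg => Primrec.list_idxOf.comp hf hg
  have h : Primrec fun z : P × List σ × List σ =>
      automatonCode (δ z.1) (start z.1) z.2.1 z.2.2 := by
    have hQ' : Primrec fun z : P × List σ × List σ => z.2.1 := Primrec.fst.comp Primrec.snd
    have htrans : ∀ c : Letter, Primrec₂ fun (z : P × List σ × List σ) (x : σ) =>
        (z.2.1.idxOf x, c, z.2.1.idxOf (δ z.1 x c)) := fun c => by
      refine Primrec.pair (hidx Primrec.snd (hQ'.comp Primrec.fst))
        (Primrec.pair (Primrec.const c) (hidx ?_ (hQ'.comp Primrec.fst)))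
      exact hδ.comp (Primrec.pair (Primrec.fst.comp Primrec.fst)
        (Primrec.pair Primrec.snd (Primrec.const c)))
    refine Primrec.pair (Primrec.list_length.comp hQ') (Primrec.pair ?_ (Primrec.pair ?_ ?_))
    · exact Primrec.list_flatMap hQ' (Primrec.list_cons.comp (htrans letterA)
        (Primrec.list_cons.comp (htrans letterB) (Primrec.const [])))
    · exact Primrec.list_cons.comp (hidx (hstart.comp Primrec.fst) hQ') (Primrec.const [])
    · exact Primrec.list_map (Primrec.snd.comp Primrec.snd)
        (hidx Primrec.snd (hQ'.comp Primrec.fst))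
  exact h.to_comp.comp (Computable.pair Computable.id (Computable.pair hQ hacc))

/-! ### Computing the states reached by a context-free language -/

/-- The states of an automaton that is given computably are computable. -/
theorem exists_computable_states {P σ : Type} [Primcodable P] [Primcodable σ]
    {δ : P → σ → Letter → σ} (hδ : Primrec fun x : P × σ × Letter => δ x.1 x.2.1 x.2.2)
    {start : P → σ} (hstart : Primrec start)
    (hfin : ∀ p, ∃ S : Set σ, S.Finite ∧ start p ∈ S ∧ ∀ x ∈ S, ∀ c, δ p x c ∈ S) :
    ∃ Q : P → List σ, Computable Q ∧
      ∀ p, start p ∈ Q p ∧ ∀ x ∈ Q p, ∀ c, δ p x c ∈ Q p := by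
  have h : ∀ c : Letter, Primrec₂ fun (z : P × List σ) (x : σ) => δ z.1 x c := fun c =>
    hδ.comp (Primrec.pair (Primrec.fst.comp Primrec.fst)
      (Primrec.pair Primrec.snd (Primrec.const c)))
  have hstep : Primrec₂ fun (p : P) (l : List σ) =>
      l ++ l.flatMap fun x => [δ p x letterA, δ p x letterB] :=
    Primrec.list_append.comp Primrec.snd (Primrec.list_flatMap Primrec.snd
      (Primrec.list_cons.comp (h letterA)
        (Primrec.list_cons.comp (h letterB) (Primrec.const []))))
  obtain ⟨Q, hQ, hQ'⟩ := exists_computable_closure (fun p => [start p]) _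
    (Primrec.list_cons.comp hstart (Primrec.const [])).to_comp hstep.to_comp
    (fun p l => List.subset_append_left _ _)
    (fun p => by
      obtain ⟨S, hS, h0, h1⟩ := hfin p
      refine ⟨S, hS, by simpa using h0, fun l hl x hx => ?_⟩
      rcases List.mem_append.1 hx with hx | hx
      · exact hl x hx
      · obtain ⟨y, hy, hx⟩ := List.mem_flatMap.1 hx
        simp only [List.mem_cons, List.not_mem_nil, or_false] at hx
        rcases hx with rfl | rfl <;> exact h1 _ (hl y hy) _)
  refine ⟨Q, hQ, fun p => ⟨(hQ' p).1 (List.mem_singleton_self _), fun x hx c => ?_⟩⟩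
  refine (hQ' p).2.1 (List.mem_append_right _ (List.mem_flatMap.2 ⟨x, hx, ?_⟩))
  cases c <;> simp

/-- The relation which connects two states if a word derived from a nonterminal leads from the one
to the other is computable. -/
theorem exists_computable_triples {P σ : Type} [Primcodable P] [Primcodable σ] [DecidableEq σ]
    {δ : P → σ → Letter → σ} (hδ : Primrec fun x : P × σ × Letter => δ x.1 x.2.1 x.2.2)
    {rules : P → List (ℕ × List (ℕ ⊕ Letter))} (hrules : Primrec rules)
    {Q : P → List σ} (hQ : Computable Q) (hQδ : ∀ p, ∀ x ∈ Q p, ∀ c, δ p x c ∈ Q p) :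
    ∃ T : P → List (σ × ℕ × σ), Computable T ∧ ∀ p,
      saturate (δ p) (rules p) (Q p) (T p) ⊆ T p ∧ ∀ e ∈ T p, e.1 ∈ Q p ∧ e.2.2 ∈ Q p ∧
      ∃ w, Yields (rules p) [Sum.inl e.2.1] w ∧ w.foldl (δ p) e.1 = e.2.2 := by
  have hstepT : Primrec₂ fun (z : P × List σ) (T : List (σ × ℕ × σ)) =>
      saturate (δ z.1) (rules z.1) z.2 T := by
    refine primrec_saturate (P := (P × List σ) × List (σ × ℕ × σ)) (δ := fun z => δ z.1.1) ?_
      (hrules.comp (Primrec.fst.comp Primrec.fst)) (Primrec.snd.comp Primrec.fst) Primrec.snd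
    exact hδ.comp (Primrec.pair (Primrec.fst.comp (Primrec.fst.comp Primrec.fst)) Primrec.snd)
  have hstep : Computable₂ fun p T => saturate (δ p) (rules p) (Q p) T := by
    have h : Computable fun x : P × List (σ × ℕ × σ) => ((x.1, Q x.1), x.2) :=
      Computable.pair (Computable.pair Computable.fst (hQ.comp Computable.fst)) Computable.snd
    exact Computable.comp (f := fun y : (P × List σ) × List (σ × ℕ × σ) =>
      saturate (δ y.1.1) (rules y.1.1) y.1.2 y.2) (Primrec.to_comp hstepT) h
  -- The first part of the invariant confines the triples to a finite set, so that the closure is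
  -- reached; the second is soundness.
  let I : P → σ × ℕ × σ → Prop := fun p e =>
    (e.1 ∈ Q p ∧ e.2.2 ∈ Q p ∧ e.2.1 ∈ (rules p).map Prod.fst) ∧
      ∃ w, Yields (rules p) [Sum.inl e.2.1] w ∧ w.foldl (δ p) e.1 = e.2.2
  have hsound : ∀ p T, (∀ e ∈ T, I p e) → ∀ e ∈ saturate (δ p) (rules p) (Q p) T, I p e := by
    intro p T hT e he
    rcases mem_saturate.1 he with he | ⟨r, hr, x, hx, y, hy, rfl⟩
    · exact hT e he
    · obtain ⟨x', hx', w, hw, rfl⟩ := exists_of_mem_reachList (fun e he => (hT e he).2) r.2 [x] hy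
      obtain rfl := List.mem_singleton.1 hx'
      refine ⟨⟨hx, List.foldlRecOn w (δ p) hx fun z hz c _ => hQδ p z hz c,
        List.mem_map_of_mem hr⟩, w, ?_, rfl⟩
      simpa using Yields.nonterminal hr hw Yields.nil
  obtain ⟨T, hT, hT'⟩ := exists_computable_closure (fun _ : P => ([] : List (σ × ℕ × σ)))
    (fun p T => saturate (δ p) (rules p) (Q p) T) (Computable.const []) hstep
    (fun p T => subset_saturate)
    (fun p => by
      have h : ({x | x ∈ Q p} ×ˢ ({B | B ∈ (rules p).map Prod.fst} ×ˢ {x | x ∈ Q p}) :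
          Set (σ × ℕ × σ)).Finite :=
        (List.finite_toSet _).prod ((List.finite_toSet _).prod (List.finite_toSet _))
      exact ⟨{e | I p e}, h.subset fun e he => ⟨he.1.1, he.1.2.2, he.1.2.1⟩,
        fun x hx => absurd hx List.not_mem_nil, hsound p⟩)
  refine ⟨T, hT, fun p => ⟨(hT' p).2.1, fun e he => ?_⟩⟩
  have := (hT' p).2.2 (I p) (fun x hx => absurd hx List.not_mem_nil) (hsound p) e he
  exact ⟨this.1.1, this.1.2.1, this.2⟩

/-- The states that are connected to `x` by the nonterminal `A`. -/
def targets {σ : Type} [DecidableEq σ] (x : σ) (A : ℕ) (T : List (σ × ℕ × σ)) : List σ :=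
  T.flatMap fun e => if e.1 = x ∧ e.2.1 = A then [e.2.2] else []

theorem mem_targets {σ : Type} [DecidableEq σ] {x y : σ} {A : ℕ} {T : List (σ × ℕ × σ)} :
    y ∈ targets x A T ↔ (x, A, y) ∈ T := by
  rw [targets, List.mem_flatMap]
  constructor
  · rintro ⟨⟨x', B, z⟩, he, h⟩
    split_ifs at h with hc
    · obtain ⟨rfl, rfl⟩ := hc
      rwa [List.mem_singleton.1 h]
    · simp at h
  · exact fun h => ⟨_, h, by simp⟩

theorem primrec_targets {P σ : Type} [Primcodable P] [Primcodable σ] [DecidableEq σ]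
    {x : P → σ} (hx : Primrec x) {A : P → ℕ} (hA : Primrec A) :
    Primrec₂ fun p T => targets (x p) (A p) T := by
  refine Primrec.list_flatMap Primrec.snd
    (Primrec.ite (PrimrecPred.and ?_ ?_) ?_ (Primrec.const []))
  · exact Primrec.eq.comp (Primrec.fst.comp Primrec.snd)
      (hx.comp (Primrec.fst.comp Primrec.fst))
  · exact Primrec.eq.comp (Primrec.fst.comp (Primrec.snd.comp Primrec.snd))
      (hA.comp (Primrec.fst.comp Primrec.fst))
  · exact Primrec.list_cons.comp (Primrec.snd.comp (Primrec.snd.comp Primrec.snd))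
      (Primrec.const [])

/-- Let a finite deterministic automaton be given computably. The set of words that lead to the
same state as some word of a context-free language is effectively regular. -/
theorem exists_computable_nfaCode {P σ : Type} [Primcodable P] [Primcodable σ]
    (δ : P → σ → Letter → σ) (hδ : Primrec fun x : P × σ × Letter => δ x.1 x.2.1 x.2.2)
    (start : P → σ) (hstart : Primrec start)
    (hfin : ∀ p, ∃ S : Set σ, S.Finite ∧ start p ∈ S ∧ ∀ x ∈ S, ∀ c, δ p x c ∈ S)
    (rules : P → List (ℕ × List (ℕ ⊕ Letter))) (hrules : Primrec rules)
    (A : P → ℕ) (hA : Primrec A) :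
    ∃ f : P → NFACode, Computable f ∧ ∀ p w, w ∈ (f p).language ↔
      ∃ w', Yields (rules p) [Sum.inl (A p)] w' ∧
        w'.foldl (δ p) (start p) = w.foldl (δ p) (start p) := by
  classical
  obtain ⟨Q, hQ, hQ'⟩ := exists_computable_states hδ hstart hfin
  obtain ⟨T, hT, hT'⟩ := exists_computable_triples hδ hrules hQ fun p => (hQ' p).2
  have hacc : Computable fun p => targets (start p) (A p) (T p) :=
    (primrec_targets hstart hA).to_comp.comp Computable.id hT
  refine ⟨_, computable_automatonCode hδ hstart hQ hacc, fun p w => ?_⟩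
  rw [mem_automatonCode_language (hQ' p).2 (hQ' p).1
    (fun y hy => ((hT' p).2 _ (mem_targets.1 hy)).2.1), mem_targets]
  constructor
  · exact fun h => ((hT' p).2 _ h).2.2
  · rintro ⟨w', hw', h⟩
    rw [← h]
    have := (foldl_mem_reachList (T := T p) (hQ' p).2 (fun r hr x hx y hy =>
      (hT' p).1 (mem_saturate.2 (Or.inr ⟨r, hr, x, hx, y, hy, rfl⟩))) hw' [start p] (start p)
      (List.mem_singleton_self _) (hQ' p).1).2
    rw [reachList, List.foldl_cons, List.foldl_nil, List.mem_flatMap] at this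
    obtain ⟨x, hx, hy⟩ := this
    rw [List.mem_singleton.1 hx] at hy
    exact mem_targets.1 hy

/-! ### Graph codes and their recognition by a transducer -/

/-- The code `a b^i a` is represented by `(i, none)`, and the code `a b^i a a a b^j a` by
`(i, some j)`. -/
abbrev GraphCode : Type := ℕ × Option ℕ

/-- The word for a code. -/
def GraphCode.word : GraphCode → List Letter
  | (i, none) => vertexWord i
  | (i, some j) => edgeWord i j

/-- The exponents in a code have to be positive. -/
def GraphCode.Valid (c : GraphCode) : Prop := 1 ≤ c.1 ∧ ∀ j ∈ c.2, 1 ≤ j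

/-- Apply a function to the exponents of a code. -/
def GraphCode.map (h : ℕ → ℕ) (c : GraphCode) : GraphCode := (h c.1, c.2.map h)

/-- The states of the transducer: the phase and the exponents of the current code.
The phases `0, …, 6` are reached by the words `1`, `a`, `a b^i`, `a b^i a`, `a b^i a a`,
`a b^i a a a`, and `a b^i a a a b^j`; the phase `7` is a sink. -/
abbrev ScanState : Type := Fin 8 × ℕ × ℕ

/-- The change of the phase when a letter is read. -/
def nextPhase : Fin 8 → Letter → Fin 8
  | 0, false => 1
  | 1, true => 2
  | 2, true => 2
  | 2, false => 3
  | 3, false => 4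
  | 4, true => 2
  | 4, false => 5
  | 5, true => 6
  | 6, true => 6
  | 6, false => 0
  | _, _ => 7

/-- The change of the state, when exponents are counted by `inc`. -/
def scanStep (inc : ℕ → ℕ) (s : ScanState) (c : Letter) : ScanState :=
  (nextPhase s.1 c,
    if c = letterB ∧ (s.1 = 1 ∨ s.1 = 4) then inc 0
    else if c = letterB ∧ s.1 = 2 then inc s.2.1 else s.2.1,
    if c = letterB ∧ s.1 = 5 then inc 0
    else if c = letterB ∧ s.1 = 6 then inc s.2.2 else s.2.2)

/-- The code that is completed when a letter is read; for vertex codes this is noticed when the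
next code begins. -/
def scanEmit (s : ScanState) (c : Letter) : Option GraphCode :=
  if c = letterB ∧ s.1 = 4 then some (s.2.1, none)
  else if c = letterA ∧ s.1 = 6 then some (s.2.1, some s.2.2) else none

/-- The initial state. -/
def scanStart : ScanState := (0, 0, 0)

/-- The code that is completed when the word ends. -/
def scanPending (s : ScanState) : List GraphCode := if s.1 = 3 then [(s.2.1, none)] else []

/-- The list of codes that are found in a word. -/
def scanCodes (inc : ℕ → ℕ) (w : List Letter) : List GraphCode :=
  outputs (scanStep inc) scanEmit scanStart w ++ scanPending (w.foldl (scanStep inc) scanStart)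

/-- The phases in which a word may end. -/
def ScanState.Final (s : ScanState) : Prop := s.1 = 0 ∨ s.1 = 3

/-- Apply a function to the exponents of a state. -/
def ScanState.map (h : ℕ → ℕ) (s : ScanState) : ScanState := (s.1, h s.2.1, h s.2.2)

/-! ### Scanning commutes with the reduction of exponents -/

section Map

variable {inc h : ℕ → ℕ} (h0 : h 0 = 0) (hs : ∀ i, h (i + 1) = inc (h i))

include h0 hs

/-- The counters never influence the phase, so a map that intertwines the two ways of counting
intertwines the two transducers. -/
theorem scanStep_map (s : ScanState) (c : Letter) :
    scanStep inc (s.map h) c = (scanStep Nat.succ s c).map h := by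
  obtain ⟨f, i, j⟩ := s
  fin_cases f <;> cases c <;> simp [scanStep, ScanState.map, hs, h0]

theorem foldl_scanStep_map (w : List Letter) (s : ScanState) :
    w.foldl (scanStep inc) (s.map h) = (w.foldl (scanStep Nat.succ) s).map h := by
  induction w generalizing s with
  | nil => rfl
  | cons c w ih => rw [List.foldl_cons, List.foldl_cons, scanStep_map h0 hs, ih]

theorem outputs_map (w : List Letter) (s : ScanState) :
    outputs (scanStep inc) scanEmit (s.map h) w =
      (outputs (scanStep Nat.succ) scanEmit s w).map (GraphCode.map h) := by
  induction w generalizing s with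
  | nil => rfl
  | cons c w ih =>
    have he : scanEmit (s.map h) c = (scanEmit s c).map (GraphCode.map h) := by
      obtain ⟨f, i, j⟩ := s
      fin_cases f <;> cases c <;> rfl
    rw [outputs, outputs, scanStep_map h0 hs, ih, he, List.map_append]
    cases scanEmit s c <;> rfl

theorem foldl_scanStart (w : List Letter) :
    w.foldl (scanStep inc) scanStart = (w.foldl (scanStep Nat.succ) scanStart).map h := by
  rw [← foldl_scanStep_map h0 hs]
  simp [ScanState.map, scanStart, h0]

theorem scanCodes_map (w : List Letter) :
    scanCodes inc w = (scanCodes Nat.succ w).map (GraphCode.map h) := by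
  have : scanStart = scanStart.map h := by simp [ScanState.map, scanStart, h0]
  rw [scanCodes, scanCodes, foldl_scanStart h0 hs, List.map_append, ← outputs_map h0 hs, ← this]
  congr 1
  generalize w.foldl (scanStep Nat.succ) scanStart = s
  obtain ⟨f, i, j⟩ := s
  fin_cases f <;> rfl

end Map

/-- The part of the word that belongs to the current code. -/
def ScanState.word : ScanState → List Letter
  | (0, _, _) => []
  | (1, _, _) => [letterA]
  | (2, i, _) => letterA :: bPow i
  | (3, i, _) => vertexWord i
  | (4, i, _) => vertexWord i ++ [letterA]
  | (5, i, _) => vertexWord i ++ [letterA, letterA]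
  | (6, i, j) => vertexWord i ++ letterA :: letterA :: bPow j
  | _ => []

theorem bPow_succ (n : ℕ) : bPow (n + 1) = bPow n ++ [letterB] := List.replicate_succ'

theorem bPow_succ' (n : ℕ) : bPow (n + 1) = letterB :: bPow n := rfl

theorem bPow_zero : bPow 0 = [] := rfl

/-- Invariant of the scan, proved by appending one letter at a time: the emitted codes and the
unfinished part together spell the word read. The bounds on the counters are carried along because
they make the next emitted code valid. -/
theorem scan_spec (w : List Letter) :
    let s := w.foldl (scanStep Nat.succ) scanStart
    let o := outputs (scanStep Nat.succ) scanEmit scanStart w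
    s.1 ≠ 7 → w = o.flatMap GraphCode.word ++ s.word ∧ (∀ c ∈ o, c.Valid) ∧
      (2 ≤ s.1 → 1 ≤ s.2.1) ∧ (s.1 = 6 → 1 ≤ s.2.2) := by
  induction w using List.reverseRecOn with
  | nil => simp [scanStart, outputs, ScanState.word]
  | append_singleton w c ih =>
    dsimp only at ih ⊢
    rw [List.foldl_append, outputs_append]
    generalize w.foldl (scanStep Nat.succ) scanStart = s at *
    generalize outputs (scanStep Nat.succ) scanEmit scanStart w = o at *
    obtain ⟨f, i, j⟩ := s
    intro h
    have hf : f ≠ 7 := by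
      rintro rfl
      exact h (by cases c <;> rfl)
    obtain ⟨rfl, h1, h2, h3⟩ := ih hf
    have h4 : ∀ x ∈ o ++ (scanEmit (f, i, j) c).toList, x.Valid := by
      intro x hx
      rcases List.mem_append.1 hx with hx | hx
      · exact h1 x hx
      · fin_cases f <;> cases c <;> simp [scanEmit] at hx <;> subst hx <;>
          simp_all [GraphCode.Valid, Fin.le_def]
    refine ⟨?_, by simpa [outputs] using h4, ?_⟩
    · clear h4 h1 h2 h3
      fin_cases f <;> cases c <;>
        simp_all [scanStep, nextPhase, outputs, scanEmit, ScanState.word, bPow_succ, bPow_zero,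
          GraphCode.word, vertexWord, edgeWord]
    · clear h4 h1
      fin_cases f <;> cases c <;> simp_all [scanStep, nextPhase, Fin.le_def]

/-- In the final phases the unfinished part in `scan_spec` is empty or a complete vertex code, and
the latter is what `scanPending` supplies. -/
theorem eq_flatMap_scanCodes {w : List Letter}
    (h : (w.foldl (scanStep Nat.succ) scanStart).Final) :
    w = (scanCodes Nat.succ w).flatMap GraphCode.word ∧
      ∀ c ∈ scanCodes Nat.succ w, c.Valid := by
  have hs := scan_spec w
  rw [scanCodes]
  dsimp only at hs
  generalize outputs (scanStep Nat.succ) scanEmit scanStart w = o at *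
  generalize w.foldl (scanStep Nat.succ) scanStart = s at *
  obtain ⟨f, i, j⟩ := s
  obtain rfl | rfl : f = 0 ∨ f = 3 := h
  · obtain ⟨h1, h2, -⟩ := hs (show (0 : Fin 8) ≠ 7 by decide)
    rw [scanPending, if_neg (show (0 : Fin 8) ≠ 3 by decide), List.append_nil]
    exact ⟨h1.trans (List.append_nil _), h2⟩
  · obtain ⟨h1, h2, h3, -⟩ := hs (show (3 : Fin 8) ≠ 7 by decide)
    have h3 : 1 ≤ i := h3 (show (2 : Fin 8) ≤ 3 by decide)
    constructor
    · simpa [scanPending, ScanState.word, GraphCode.word] using h1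
    · intro c hc
      rcases List.mem_append.1 hc with hc | hc
      · exact h2 c hc
      · obtain rfl : c = (i, none) := by simpa [scanPending] using hc
        exact ⟨h3, by simp⟩

/-! ### Scanning vertex words and codes -/

section Forward

variable (i j n : ℕ)

theorem scan_bPow_two : (bPow n).foldl (scanStep Nat.succ) (2, i, j) = (2, i + n, j) ∧
    outputs (scanStep Nat.succ) scanEmit (2, i, j) (bPow n) = [] := by
  induction n generalizing i with
  | zero => exact ⟨rfl, rfl⟩
  | succ n ih =>
    obtain ⟨h1, h2⟩ := ih (i + 1)
    rw [bPow_succ', List.foldl_cons, outputs]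
    change (bPow n).foldl (scanStep Nat.succ) (2, i + 1, j) = _ ∧
      [] ++ outputs (scanStep Nat.succ) scanEmit (2, i + 1, j) (bPow n) = []
    rw [h1, h2]
    exact ⟨by rw [add_right_comm, add_assoc], rfl⟩

theorem scan_bPow_six : (bPow n).foldl (scanStep Nat.succ) (6, i, j) = (6, i, j + n) ∧
    outputs (scanStep Nat.succ) scanEmit (6, i, j) (bPow n) = [] := by
  induction n generalizing j with
  | zero => exact ⟨rfl, rfl⟩
  | succ n ih =>
    obtain ⟨h1, h2⟩ := ih (j + 1)
    rw [bPow_succ', List.foldl_cons, outputs]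
    change (bPow n).foldl (scanStep Nat.succ) (6, i, j + 1) = _ ∧
      [] ++ outputs (scanStep Nat.succ) scanEmit (6, i, j + 1) (bPow n) = []
    rw [h1, h2]
    exact ⟨by rw [add_right_comm, add_assoc], rfl⟩

theorem scan_sink (w : List Letter) (s : ScanState) (hs : s.1 = 7) :
    (w.foldl (scanStep Nat.succ) s).1 = 7 := by
  induction w generalizing s with
  | nil => exact hs
  | cons c w ih =>
    refine ih _ ?_
    obtain ⟨f, i, j⟩ := s
    obtain rfl : f = 7 := hs
    cases c <;> rfl

variable {n} (hn : 1 ≤ n)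

include hn

theorem scan_vertexWord_zero :
    (vertexWord n).foldl (scanStep Nat.succ) (0, i, j) = (3, n, j) ∧
    outputs (scanStep Nat.succ) scanEmit (0, i, j) (vertexWord n) = [] := by
  obtain ⟨k, rfl⟩ := Nat.exists_eq_add_of_le' hn
  obtain ⟨h1, h2⟩ := scan_bPow_two 1 j k
  -- The leading letters `a b` lead to phase `2` with counter `1`, leaving `k` letters `b`.
  change ((bPow k ++ [letterA]).foldl (scanStep Nat.succ) (2, 1, j)) = _ ∧
    [] ++ ([] ++ outputs (scanStep Nat.succ) scanEmit (2, 1, j) (bPow k ++ [letterA])) = []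
  rw [List.foldl_append, outputs_append, h1, h2, add_comm]
  exact ⟨rfl, rfl⟩

theorem scan_vertexWord_three :
    (vertexWord n).foldl (scanStep Nat.succ) (3, i, j) = (3, n, j) ∧
    outputs (scanStep Nat.succ) scanEmit (3, i, j) (vertexWord n) = [(i, none)] := by
  obtain ⟨k, rfl⟩ := Nat.exists_eq_add_of_le' hn
  obtain ⟨h1, h2⟩ := scan_bPow_two 1 j k
  change ((bPow k ++ [letterA]).foldl (scanStep Nat.succ) (2, 1, j)) = _ ∧
    [] ++ ([(i, none)] ++ outputs (scanStep Nat.succ) scanEmit (2, 1, j)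
      (bPow k ++ [letterA])) = _
  rw [List.foldl_append, outputs_append, h1, h2, add_comm]
  exact ⟨rfl, rfl⟩

theorem scan_vertexWord_four :
    (vertexWord n).foldl (scanStep Nat.succ) (4, i, j) = (0, i, n) ∧
    outputs (scanStep Nat.succ) scanEmit (4, i, j) (vertexWord n) = [(i, some n)] := by
  obtain ⟨k, rfl⟩ := Nat.exists_eq_add_of_le' hn
  obtain ⟨h1, h2⟩ := scan_bPow_six i 1 k
  change ((bPow k ++ [letterA]).foldl (scanStep Nat.succ) (6, i, 1)) = _ ∧
    [] ++ ([] ++ outputs (scanStep Nat.succ) scanEmit (6, i, 1) (bPow k ++ [letterA])) = _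
  rw [List.foldl_append, outputs_append, h1, h2, add_comm]
  exact ⟨rfl, rfl⟩

/-- Reading the word `a b^n a` from an arbitrary state. -/
theorem scan_vertexWord (s : ScanState) :
    ((vertexWord n).foldl (scanStep Nat.succ) s).1 = 7 ∨
    ((vertexWord n).foldl (scanStep Nat.succ) s).1 = 3 ∧
      ((vertexWord n).foldl (scanStep Nat.succ) s).2.1 = n ∧ s.Final ∨
    s.1 = 4 ∧ ((vertexWord n).foldl (scanStep Nat.succ) s).1 = 0 ∧
      outputs (scanStep Nat.succ) scanEmit s (vertexWord n) = [(s.2.1, some n)] := by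
  obtain ⟨k, hk⟩ := Nat.exists_eq_add_of_le' hn
  -- The first two letters `a b` already decide: from every phase other than `0`, `3` and `4` they
  -- lead to the sink.
  have hsink : ∀ i j, (scanStep Nat.succ (scanStep Nat.succ s letterA) letterB) = (7, i, j) →
      ((vertexWord n).foldl (scanStep Nat.succ) s).1 = 7 := by
    intro i j h
    rw [hk]
    change ((bPow k ++ [letterA]).foldl (scanStep Nat.succ)
      (scanStep Nat.succ (scanStep Nat.succ s letterA) letterB)).1 = 7
    exact scan_sink _ _ (by rw [h])
  obtain ⟨f, i, j⟩ := s
  fin_cases f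
  · exact Or.inr (Or.inl ⟨congrArg Prod.fst (scan_vertexWord_zero i j hn).1,
      congrArg (fun s => s.2.1) (scan_vertexWord_zero i j hn).1, Or.inl rfl⟩)
  · exact Or.inl (hsink _ _ rfl)
  · exact Or.inl (hsink _ _ rfl)
  · exact Or.inr (Or.inl ⟨congrArg Prod.fst (scan_vertexWord_three i j hn).1,
      congrArg (fun s => s.2.1) (scan_vertexWord_three i j hn).1, Or.inr rfl⟩)
  · exact Or.inr (Or.inr ⟨rfl, congrArg Prod.fst (scan_vertexWord_four i j hn).1,
      (scan_vertexWord_four i j hn).2⟩)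
  · exact Or.inl (hsink _ _ rfl)
  · exact Or.inl (hsink _ _ rfl)
  · exact Or.inl (hsink _ _ rfl)

end Forward

/-- The pending code is pushed out when the next one is read, and `c` itself is emitted or becomes
pending. This form of the identity telescopes over a list of codes. -/
theorem scan_codeWord {s : ScanState} (hs : s.Final) {c : GraphCode} (hc : c.Valid) :
    (c.word.foldl (scanStep Nat.succ) s).Final ∧
    outputs (scanStep Nat.succ) scanEmit s c.word ++
      scanPending (c.word.foldl (scanStep Nat.succ) s) = scanPending s ++ [c] := by
  obtain ⟨f, i, j⟩ := s
  obtain ⟨m, _ | n⟩ := c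
  · obtain rfl | rfl : f = 0 ∨ f = 3 := hs
    · obtain ⟨h1, h2⟩ := scan_vertexWord_zero i j hc.1
      rw [GraphCode.word, h1, h2]
      exact ⟨Or.inr rfl, rfl⟩
    · obtain ⟨h1, h2⟩ := scan_vertexWord_three i j hc.1
      rw [GraphCode.word, h1, h2]
      exact ⟨Or.inr rfl, rfl⟩
  · obtain ⟨h3, h4⟩ := scan_vertexWord_four m j (hc.2 n rfl)
    have h5 : scanStep Nat.succ (3, m, j) letterA = (4, m, j) := rfl
    obtain rfl | rfl : f = 0 ∨ f = 3 := hs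
    · obtain ⟨h1, h2⟩ := scan_vertexWord_zero i j hc.1
      rw [GraphCode.word, edgeWord, outputs_append, List.foldl_append, h1, h2, outputs,
        List.foldl_cons, h5, h3, h4]
      exact ⟨Or.inl rfl, rfl⟩
    · obtain ⟨h1, h2⟩ := scan_vertexWord_three i j hc.1
      rw [GraphCode.word, edgeWord, outputs_append, List.foldl_append, h1, h2, outputs,
        List.foldl_cons, h5, h3, h4]
      exact ⟨Or.inl rfl, rfl⟩

theorem scan_flatMap_word {Z : List GraphCode} (hZ : ∀ c ∈ Z, c.Valid) {s : ScanState}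
    (hs : s.Final) : ((Z.flatMap GraphCode.word).foldl (scanStep Nat.succ) s).Final ∧
    outputs (scanStep Nat.succ) scanEmit s (Z.flatMap GraphCode.word) ++
      scanPending ((Z.flatMap GraphCode.word).foldl (scanStep Nat.succ) s) =
      scanPending s ++ Z := by
  induction Z generalizing s with
  | nil => exact ⟨hs, (List.append_nil _).symm⟩
  | cons c Z ih =>
    obtain ⟨h1, h2⟩ := scan_codeWord hs (hZ c List.mem_cons_self)
    obtain ⟨h3, h4⟩ := ih (fun c hc => hZ c (List.mem_cons_of_mem _ hc)) h1
    rw [List.flatMap_cons, List.foldl_append, outputs_append, List.append_assoc, h4,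
      ← List.append_assoc, h2, List.append_assoc]
    exact ⟨h3, rfl⟩

theorem scanCodes_flatMap_word {Z : List GraphCode} (hZ : ∀ c ∈ Z, c.Valid) :
    ((Z.flatMap GraphCode.word).foldl (scanStep Nat.succ) scanStart).Final ∧
    scanCodes Nat.succ (Z.flatMap GraphCode.word) = Z :=
  scan_flatMap_word hZ (Or.inl rfl)

theorem exists_codes_of_mem_graphWords {w : List Letter} (hw : w ∈ graphWords) :
    ∃ Z : List GraphCode, (∀ c ∈ Z, c.Valid) ∧ w = Z.flatMap GraphCode.word := by
  obtain ⟨l, rfl, hl⟩ := Language.mem_kstar.1 hw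
  clear hw
  induction l with
  | nil => exact ⟨[], by simp, rfl⟩
  | cons u l ih =>
    have hl' := fun y hy => hl y (List.mem_cons_of_mem u hy)
    obtain ⟨Z, hZ, h⟩ := ih hl'
    obtain ⟨c, hc, rfl⟩ : ∃ c : GraphCode, c.Valid ∧ u = c.word := by
      rcases hl u List.mem_cons_self with ⟨i, hi, rfl⟩ | ⟨i, j, hi, hj, rfl⟩
      · exact ⟨(i, none), ⟨hi, by simp⟩, rfl⟩
      · exact ⟨(i, some j), ⟨hi, by simpa using hj⟩, rfl⟩
    refine ⟨c :: Z, ?_, ?_⟩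
    · intro d hd
      rcases List.mem_cons.1 hd with rfl | hd
      · exact hc
      · exact hZ d hd
    · rw [List.flatten_cons, List.flatMap_cons, h]

/-- Since only the phase is tested, the test is also valid for the transducer with reduced
exponents. -/
theorem mem_graphWords_iff (w : List Letter) :
    w ∈ graphWords ↔ (w.foldl (scanStep Nat.succ) scanStart).Final := by
  constructor
  · intro hw
    obtain ⟨Z, hZ, rfl⟩ := exists_codes_of_mem_graphWords hw
    exact (scanCodes_flatMap_word hZ).1
  · intro h
    obtain ⟨h1, h2⟩ := eq_flatMap_scanCodes h
    rw [h1, List.flatMap]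
    refine Language.join_mem_kstar fun y hy => ?_
    obtain ⟨⟨i, _ | j⟩, hc, rfl⟩ := List.mem_map.1 hy
    · exact Or.inl ⟨i, (h2 _ hc).1, rfl⟩
    · exact Or.inr ⟨i, j, (h2 _ hc).1, (h2 _ hc).2 j rfl, rfl⟩

/-! ### The graph of a word depends on its set of codes only -/

/-- An edge factor cannot straddle codes. Avoiding the sink, its first half ends in phase `3` or
`0`; in phase `0` the following letters `a a` would lead to the sink, so the phase is `3`, and the
second half completes exactly this edge code. -/
theorem mem_scanCodes_of_edgeWord_infix {w : List Letter} (hw : w ∈ graphWords) {m n : ℕ}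
    (hm : 1 ≤ m) (hn : 1 ≤ n) (h : edgeWord m n <:+: w) : (m, some n) ∈ scanCodes Nat.succ w := by
  obtain ⟨x, y, rfl⟩ := h
  rw [mem_graphWords_iff] at hw
  have hns : ∀ (u v : List Letter), x ++ edgeWord m n ++ y = u ++ v →
      (u.foldl (scanStep Nat.succ) scanStart).1 ≠ 7 := by
    intro u v h h7
    rw [h, List.foldl_append] at hw
    have := scan_sink v _ h7
    rcases hw with hw | hw <;> rw [this] at hw <;> exact absurd hw (by decide)
  have e1 : x ++ edgeWord m n ++ y = x ++ vertexWord m ++ (letterA :: vertexWord n ++ y) := by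
    simp [edgeWord]
  have e2 : x ++ edgeWord m n ++ y = x ++ vertexWord m ++ [letterA] ++ vertexWord n ++ y := by
    simp [edgeWord]
  have h1 := hns _ _ e1
  have h2 := hns _ _ e2
  simp only [List.foldl_append, List.foldl_cons, List.foldl_nil] at h1 h2
  rw [scanCodes, e2]
  refine List.mem_append_left _ ?_
  rw [outputs_append, outputs_append]
  refine List.mem_append_left _ (List.mem_append_right _ ?_)
  simp only [List.foldl_append, List.foldl_cons, List.foldl_nil]
  generalize x.foldl (scanStep Nat.succ) scanStart = s at *
  rcases scan_vertexWord hm s with h | ⟨h3, h4, -⟩ | ⟨-, h3, -⟩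
  · exact absurd h h1
  · generalize (vertexWord m).foldl (scanStep Nat.succ) s = s' at *
    obtain ⟨f, i, j⟩ := s'
    obtain rfl : f = 3 := h3
    obtain rfl : i = m := h4
    rw [show scanStep Nat.succ (3, i, j) letterA = (4, i, j) from rfl,
      (scan_vertexWord_four i j hn).2]
    exact List.mem_singleton_self _
  · generalize (vertexWord m).foldl (scanStep Nat.succ) s = s' at *
    obtain ⟨f, i, j⟩ := s'
    obtain rfl : f = 0 := h3
    rw [show scanStep Nat.succ (0, i, j) letterA = (1, i, j) from rfl] at h2
    rcases scan_vertexWord hn (1, i, j) with h | ⟨-, -, h | h⟩ | ⟨h, -⟩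
    · exact absurd h h2
    all_goals exact absurd h (show ¬ (1 : Fin 8) = _ by decide)

/-- From phases `3` to `6` the first counter stays unchanged until its code is emitted or the word
ends with the code pending, whether it becomes a vertex code or the source of an edge. -/
theorem exists_mem_of_pending (y : List Letter) {s : ScanState}
    (hs : s.1 = 3 ∨ s.1 = 4 ∨ s.1 = 5 ∨ s.1 = 6) (hy : (y.foldl (scanStep Nat.succ) s).Final) :
    ∃ c ∈ outputs (scanStep Nat.succ) scanEmit s y ++
      scanPending (y.foldl (scanStep Nat.succ) s), c.1 = s.2.1 := by
  induction y generalizing s with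
  | nil =>
    obtain ⟨f, i, j⟩ := s
    obtain rfl | rfl : f = 0 ∨ f = 3 := hy
    · exact absurd hs (show ¬ ((0 : Fin 8) = 3 ∨ (0 : Fin 8) = 4 ∨ (0 : Fin 8) = 5 ∨ (0 : Fin 8) = 6)
        by decide)
    · exact ⟨(i, none), List.mem_singleton_self _, rfl⟩
  | cons c y ih =>
    rw [List.foldl_cons] at hy
    have hns : (scanStep Nat.succ s c).1 ≠ 7 := by
      intro h7
      have := scan_sink y _ h7
      rcases hy with hy | hy <;> rw [this] at hy <;> exact absurd hy (by decide)
    have key : (∃ d ∈ (scanEmit s c).toList, d.1 = s.2.1) ∨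
        (((scanStep Nat.succ s c).1 = 3 ∨ (scanStep Nat.succ s c).1 = 4 ∨
          (scanStep Nat.succ s c).1 = 5 ∨ (scanStep Nat.succ s c).1 = 6) ∧
          (scanStep Nat.succ s c).2.1 = s.2.1) := by
      clear ih hy
      obtain ⟨f, i, j⟩ := s
      dsimp only at hs
      rcases hs with rfl | rfl | rfl | rfl <;> cases c <;>
        simp_all [scanStep, nextPhase, scanEmit]
    rw [outputs, List.foldl_cons, List.append_assoc]
    rcases key with ⟨d, hd, h⟩ | ⟨h1, h2⟩
    · exact ⟨d, List.mem_append_left _ hd, h⟩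
    · obtain ⟨d, hd, h⟩ := ih h1 hy
      exact ⟨d, List.mem_append_right _ hd, h.trans h2⟩

/-- The factor is read either as the beginning of a code, whose exponent is emitted later, or as the
target of an edge code, which it completes. -/
theorem exists_mem_scanCodes_of_vertexWord_infix {w : List Letter} (hw : w ∈ graphWords) {m : ℕ}
    (hm : 1 ≤ m) (h : vertexWord m <:+: w) :
    ∃ c ∈ scanCodes Nat.succ w, c.1 = m ∨ c.2 = some m := by
  obtain ⟨x, y, rfl⟩ := h
  rw [mem_graphWords_iff] at hw
  rw [scanCodes, outputs_append, outputs_append]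
  rw [List.foldl_append] at hw ⊢
  rcases scan_vertexWord hm (x.foldl (scanStep Nat.succ) scanStart) with h | ⟨h3, h4, -⟩ | ⟨-, -, h⟩
  · rw [List.foldl_append] at hw
    have := scan_sink y _ h
    rcases hw with hw | hw <;> rw [this] at hw <;> exact absurd hw (by decide)
  · rw [← List.foldl_append] at h3 h4
    obtain ⟨c, hc, h⟩ := exists_mem_of_pending y (Or.inl h3) hw
    refine ⟨c, ?_, Or.inl (h.trans h4)⟩
    rw [List.append_assoc]
    refine List.mem_append_right _ ?_
    simpa only [List.foldl_append] using hc
  · refine ⟨((x.foldl (scanStep Nat.succ) scanStart).2.1, some m), ?_, Or.inr rfl⟩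
    simp [h]

theorem GraphCode.word_infix_of_mem {w : List Letter} (hw : w ∈ graphWords) {c : GraphCode}
    (hc : c ∈ scanCodes Nat.succ w) : c.word <:+: w := by
  rw [(eq_flatMap_scanCodes ((mem_graphWords_iff w).1 hw)).1]
  obtain ⟨l₁, l₂, h⟩ := List.append_of_mem hc
  rw [h, List.flatMap_append, List.flatMap_cons]
  exact ⟨_, _, List.append_assoc _ _ _⟩

theorem wordGraph_verts {w : List Letter} (hw : w ∈ graphWords) :
    (wordGraph w).verts = {x | ∃ m, 1 ≤ m ∧ x = vertexWord m ∧
      ∃ c ∈ scanCodes Nat.succ w, c.1 = m ∨ c.2 = some m} := by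
  ext x
  refine exists_congr fun m => and_congr_right fun hm => and_congr_right fun _ =>
    ⟨exists_mem_scanCodes_of_vertexWord_infix hw hm, ?_⟩
  rintro ⟨⟨i, j⟩, hc, h⟩
  refine List.IsInfix.trans ?_ (GraphCode.word_infix_of_mem hw hc)
  obtain rfl | rfl : i = m ∨ j = some m := h
  · cases j
    · exact List.infix_rfl
    · exact (List.prefix_append _ _).isInfix
  · exact ((List.suffix_cons _ _).trans (List.suffix_append _ _)).isInfix

theorem wordGraph_edges {w : List Letter} (hw : w ∈ graphWords) :
    (wordGraph w).edges = {e | ∃ m n, 1 ≤ m ∧ 1 ≤ n ∧ e = (vertexWord m, vertexWord n) ∧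
      (m, some n) ∈ scanCodes Nat.succ w} := by
  ext e
  refine exists_congr fun m => exists_congr fun n => and_congr_right fun hm =>
    and_congr_right fun hn => and_congr_right fun _ =>
    ⟨mem_scanCodes_of_edgeWord_infix hw hm hn, fun h => GraphCode.word_infix_of_mem hw h⟩

/-- Graph words with the same set of codes represent the same graph. -/
theorem wordGraph_eq {w w' : List Letter} (hw : w ∈ graphWords) (hw' : w' ∈ graphWords)
    (h : ∀ c, c ∈ scanCodes Nat.succ w ↔ c ∈ scanCodes Nat.succ w') :
    wordGraph w = wordGraph w' := by
  ext x
  · rw [wordGraph_verts hw, wordGraph_verts hw']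
    simp only [h]
  · rw [wordGraph_edges hw, wordGraph_edges hw']
    simp only [h]

/-! ### Exponents modulo the torsion -/

/-- The successor function on the exponents `0, …, t + p - 1`, where `t + p` is identified
with `t`. -/
def torsionSucc (t p i : ℕ) : ℕ := if i + 1 < t + p then i + 1 else t

/-- The reduction of an exponent. -/
def torsionReduce (t p : ℕ) : ℕ → ℕ
  | 0 => 0
  | i + 1 => torsionSucc t p (torsionReduce t p i)

section Torsion

variable {L : Language Letter} {t p : ℕ} (hp : 1 ≤ p) (hL : TorsionProperty L t p)

include hp hL

/-- Induction on the exponent with the last `b` moved into the right context; torsion is used only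
when the reduced exponent wraps around. -/
theorem mem_iff_torsionReduce (i : ℕ) (x y : List Letter) :
    x ++ bPow i ++ y ∈ L ↔ x ++ bPow (torsionReduce t p i) ++ y ∈ L := by
  have hlt : ∀ i, torsionReduce t p i < t + p := by
    intro i
    induction i with
    | zero => exact Nat.add_pos_right t hp
    | succ i ih =>
      rw [torsionReduce, torsionSucc]
      split_ifs <;> lia
  induction i generalizing x y with
  | zero => rfl
  | succ i ih =>
    have h1 : ∀ k, x ++ bPow (k + 1) ++ y = x ++ bPow k ++ (letterB :: y) := fun k => by
      rw [bPow_succ]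
      simp
    rw [h1]
    refine (ih x _).trans ?_
    rw [← h1, torsionReduce, torsionSucc]
    split_ifs with h
    · rfl
    -- As reduced exponents stay below `t + p`, the failed comparison means equality, and `b^(t+p)`
    -- is traded for `b^t`.
    · rw [show torsionReduce t p i + 1 = t + p by have := hlt i; lia]
      exact (hL x y).symm

theorem mem_iff_of_torsionReduce_eq {i j : ℕ} (h : torsionReduce t p i = torsionReduce t p j)
    (x y : List Letter) : x ++ bPow i ++ y ∈ L ↔ x ++ bPow j ++ y ∈ L := by
  rw [mem_iff_torsionReduce hp hL i, mem_iff_torsionReduce hp hL j, h]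

theorem mem_iff_of_map_code_eq {c d : GraphCode}
    (h : c.map (torsionReduce t p) = d.map (torsionReduce t p)) (x y : List Letter) :
    x ++ c.word ++ y ∈ L ↔ x ++ d.word ++ y ∈ L := by
  have hv : ∀ {i i'}, torsionReduce t p i = torsionReduce t p i' → ∀ x y : List Letter,
      x ++ vertexWord i ++ y ∈ L ↔ x ++ vertexWord i' ++ y ∈ L := by
    intro i i' h x y
    have := mem_iff_of_torsionReduce_eq hp hL h (x ++ [letterA]) (letterA :: y)
    simpa [vertexWord] using this
  obtain ⟨i, _ | j⟩ := c <;> obtain ⟨i', _ | j'⟩ := d <;> simp only [GraphCode.map,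
    Prod.mk.injEq, Option.map_none, Option.map_some, Option.some.injEq, reduceCtorEq,
    and_false, and_true] at h
  · exact hv h x y
  -- The exponents are exchanged one after the other, passing through the edge code with exponents
  -- `i'` and `j`.
  · have h1 := hv h.1 x (letterA :: vertexWord j ++ y)
    have h2 := hv h.2 (x ++ vertexWord i' ++ [letterA]) y
    simp only [GraphCode.word, edgeWord, List.append_assoc, List.cons_append,
      List.nil_append] at h1 h2 ⊢
    exact h1.trans h2

theorem flatMap_mem_iff_of_map_eq {Z Z' : List GraphCode}
    (h : Z.map (GraphCode.map (torsionReduce t p)) = Z'.map (GraphCode.map (torsionReduce t p)))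
    (x : List Letter) :
    x ++ Z.flatMap GraphCode.word ∈ L ↔ x ++ Z'.flatMap GraphCode.word ∈ L := by
  induction Z generalizing Z' x with
  | nil =>
    obtain rfl : Z' = [] := List.map_eq_nil_iff.1 h.symm
    rfl
  | cons c Z ih =>
    obtain ⟨d, Z', rfl, hd, hZ⟩ := List.map_eq_cons_iff.1 h.symm
    rw [List.flatMap_cons, List.flatMap_cons, ← List.append_assoc, ← List.append_assoc,
      mem_iff_of_map_code_eq hp hL hd.symm]
    exact ih hZ.symm _

end Torsion

/-! ### The transducer with a bounded memory -/

/-- Store an output, unless it has been stored more than `B` times already. -/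
def boundedPush (B : ℕ) (v : List GraphCode) (o : Option GraphCode) : List GraphCode :=
  o.elim v fun c => if v.count c ≤ B then c :: v else v

/-- The transducer with a memory for the outputs. -/
def memoryStep (inc : ℕ → ℕ) (B : ℕ) (s : ScanState × List GraphCode) (c : Letter) :
    ScanState × List GraphCode :=
  (scanStep inc s.1 c, boundedPush B s.2 (scanEmit s.1 c))

theorem count_boundedPush {B : ℕ} {v : List GraphCode} (hv : ∀ x, v.count x ≤ B + 1)
    (o : Option GraphCode) (x : GraphCode) :
    (boundedPush B v o).count x = min (v.count x + o.toList.count x) (B + 1) := by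
  have := hv x
  cases o with
  | none => simpa [boundedPush] using this
  | some c =>
    simp only [boundedPush, Option.elim_some, Option.toList_some]
    by_cases hx : c = x
    · subst hx
      split_ifs <;> simp <;> lia
    · split_ifs <;> simpa [List.count_cons, hx] using this

/-- Counting truncated at `B + 1` is compatible with addition, so the memory determines every
multiplicity up to `B` and detects the larger ones. -/
theorem foldl_memoryStep (inc : ℕ → ℕ) (B : ℕ) (w : List Letter) (s : ScanState)
    (v : List GraphCode) (hv : ∀ x, v.count x ≤ B + 1) :
    (w.foldl (memoryStep inc B) (s, v)).1 = w.foldl (scanStep inc) s ∧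
    ∀ x, (w.foldl (memoryStep inc B) (s, v)).2.count x =
      min (v.count x + (outputs (scanStep inc) scanEmit s w).count x) (B + 1) := by
  induction w generalizing s v with
  | nil => exact ⟨rfl, fun x => by simpa [outputs] using hv x⟩
  | cons c w ih =>
    have hc := count_boundedPush hv (scanEmit s c)
    obtain ⟨h1, h2⟩ := ih (scanStep inc s c) (boundedPush B v (scanEmit s c))
      (fun x => (hc x).trans_le (min_le_right _ _))
    refine ⟨h1, fun x => (h2 x).trans ?_⟩
    rw [hc, outputs, List.count_append]
    lia

/-- The states with exponents at most `N`. -/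
def boundedStates (N : ℕ) : Set ScanState := Set.univ ×ˢ (Set.Iic N ×ˢ Set.Iic N)

theorem boundedStates_finite (N : ℕ) : (boundedStates N).Finite :=
  Set.finite_univ.prod ((Set.finite_Iic N).prod (Set.finite_Iic N))

theorem ncard_boundedStates (N : ℕ) : (boundedStates N).ncard = 8 * ((N + 1) * (N + 1)) := by
  have : (Set.Iic N).ncard = N + 1 := by
    rw [← Finset.coe_Iic, Set.ncard_coe_finset, Nat.card_Iic]
  rw [boundedStates, Set.ncard_prod, Set.ncard_prod, Set.ncard_univ, this]
  simp

theorem scanStep_mem_boundedStates {inc : ℕ → ℕ} {N : ℕ} (hinc : ∀ i, inc i ≤ N) :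
    ∀ s ∈ boundedStates N, ∀ c, scanStep inc s c ∈ boundedStates N := by
  rintro s ⟨-, h1, h2⟩ c
  refine ⟨trivial, ?_, ?_⟩ <;> simp only [scanStep, Set.mem_Iic] at * <;> split_ifs <;>
    first | exact hinc _ | assumption

theorem exists_finite_memoryStep {inc : ℕ → ℕ} {N : ℕ} (hinc : ∀ i, inc i ≤ N) (B : ℕ) :
    ∃ S : Set (ScanState × List GraphCode), S.Finite ∧ (scanStart, []) ∈ S ∧
      ∀ x ∈ S, ∀ c, memoryStep inc B x c ∈ S := by
  have hfin : ((Set.Iic N) ×ˢ (insert none (some '' Set.Iic N)) : Set GraphCode).Finite :=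
    (Set.finite_Iic N).prod (((Set.finite_Iic N).image some).insert none)
  obtain ⟨Γ, hΓ⟩ : ∃ Γ : List GraphCode, ∀ i j, i ≤ N → j ≤ N → (i, none) ∈ Γ ∧ (i, some j) ∈ Γ :=
    ⟨hfin.toFinset.toList, fun i j hi hj => by simp [hi, hj]⟩
  -- A list containing every possible output at least `B + 1` times; each memory is a permutation of
  -- one of its sublists, which leaves finitely many.
  let big := Γ.flatMap (List.replicate (B + 1))
  have hbig : ∀ c ∈ Γ, B + 1 ≤ big.count c := by
    intro c hc
    have h : (List.replicate (B + 1) c).Sublist big :=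
      List.sublist_flatten_of_mem (List.mem_map_of_mem hc)
    simpa using h.count_le c
  refine ⟨boundedStates N ×ˢ {v | v.Subperm big ∧ ∀ x, v.count x ≤ B + 1},
    (boundedStates_finite N).prod ?_, ⟨⟨trivial, Nat.zero_le _, Nat.zero_le _⟩, ?_⟩, ?_⟩
  · refine (List.finite_toSet (big.sublists.flatMap List.permutations)).subset ?_
    rintro v ⟨⟨l, hl, h⟩, -⟩
    exact List.mem_flatMap.2 ⟨l, List.mem_sublists.2 h, List.mem_permutations.2 hl.symm⟩
  · exact ⟨List.nil_subperm, by simp⟩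
  · rintro ⟨s, v⟩ ⟨hs, hv, hv'⟩ c
    refine ⟨scanStep_mem_boundedStates hinc s hs c, ?_, fun x =>
      (count_boundedPush hv' _ x).trans_le (min_le_right _ _)⟩
    have he : ∀ x, scanEmit s c = some x → x ∈ Γ := by
      intro x hx
      obtain ⟨-, h1, h2⟩ := hs
      simp only [scanEmit] at hx
      split_ifs at hx
      · obtain rfl := Option.some.inj hx
        exact (hΓ _ _ h1 h2).1
      · obtain rfl := Option.some.inj hx
        exact (hΓ _ _ h1 h2).2
    refine List.subperm_ext_iff.2 fun x _ => ?_
    change (boundedPush B v (scanEmit s c)).count x ≤ _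
    by_cases hx : scanEmit s c = some x
    · rw [count_boundedPush hv']
      exact (min_le_right _ _).trans (hbig x (he x hx))
    · have h0 : (scanEmit s c).toList.count x = 0 :=
        List.count_eq_zero.2 (by simpa [eq_comm] using hx)
      rw [count_boundedPush hv', h0, add_zero]
      exact (min_le_left _ _).trans (hv.count_le x)

/-- A list can be relabelled so that it uses exactly the labels that occur in another list. -/
theorem exists_map_eq_of_subperm {α β : Type} (φ : α → β) (X : List α) (Y : List β)
    (hle : (X.map φ).Subperm Y) (hsub : Y ⊆ X.map φ) :
    ∃ Z : List α, Z.map φ = Y ∧ ∀ x, x ∈ Z ↔ x ∈ X := by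
  obtain ⟨l, hl⟩ : ∃ l, (X.map φ ++ l).Perm Y := by
    obtain ⟨l', h1, h2⟩ := hle
    obtain ⟨l, h⟩ := h2.exists_perm_append
    exact ⟨l, (h.trans (h1.append_right l)).symm⟩
  have hlX : ∀ y ∈ l, ∃ x ∈ X, φ x = y := fun y hy =>
    List.mem_map.1 (hsub (hl.subset (List.mem_append_right _ hy)))
  -- The surplus entries of `Y` receive labels that already occur in `X`.
  obtain ⟨P, hP, hPX⟩ : ∃ P : List α, P.map φ = l ∧ P ⊆ X := by
    clear hl
    induction l with
    | nil => exact ⟨[], rfl, List.nil_subset _⟩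
    | cons y l ih =>
      obtain ⟨P, rfl, hPX⟩ := ih fun y hy => hlX y (List.mem_cons_of_mem _ hy)
      obtain ⟨x, hx, rfl⟩ := hlX y List.mem_cons_self
      exact ⟨x :: P, rfl, List.cons_subset.2 ⟨hx, hPX⟩⟩
  rw [← hP, ← List.map_append] at hl
  -- The labels `X ++ P` are rearranged so that they lie over `Y` entry by entry.
  obtain ⟨Z, hZ, h⟩ := List.perm_comp_forall₂ (r := fun y x => φ x = y) hl.symm
    (List.forall₂_map_left_iff.2 (List.forall₂_same.2 fun _ _ => rfl))
  have hZY : Z.map φ = Y := by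
    clear hl h hsub hle hP
    induction hZ with
    | nil => rfl
    | cons h _ ih => rw [List.map_cons, h, ih]
  refine ⟨Z, hZY, fun x => ?_⟩
  rw [h.mem_iff, List.mem_append]
  exact ⟨fun h => h.elim id fun h => hPX h, Or.inl⟩

/-! ### The construction of the automaton -/

/-- The grammars together with the parameters of the torsion property. -/
abbrev TorsionInput : Type := GrammarCode × ℕ × ℕ

/-- A bound for the lengths of the right-hand sides of the rules. -/
def ruleBound (g : GrammarCode) : ℕ := (g.2.flatMap Prod.snd).length + 1

/-- A bound for the number of nonterminals together with two states of the transducer. -/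
def heightBound (z : TorsionInput) : ℕ :=
  z.1.2.length * ((8 * ((z.2.1 + z.2.2 + 1) * (z.2.1 + z.2.2 + 1))) *
    (8 * ((z.2.1 + z.2.2 + 1) * (z.2.1 + z.2.2 + 1))))

/-- A letter which occurs more often can be pumped. -/
def pumpBound (z : TorsionInput) : ℕ := ruleBound z.1 ^ heightBound z

theorem torsionSucc_le (t p i : ℕ) : torsionSucc t p i ≤ t + p := by
  rw [torsionSucc]
  split_ifs <;> lia

/-! ### The transducer and its bounds are primitive recursive -/

theorem primrec_pumpBound : Primrec pumpBound := by
  have hN : Primrec fun z : TorsionInput => z.2.1 + z.2.2 + 1 :=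
    Primrec.succ.comp (Primrec.nat_add.comp (Primrec.fst.comp Primrec.snd)
      (Primrec.snd.comp Primrec.snd))
  have hM : Primrec fun z : TorsionInput =>
      8 * ((z.2.1 + z.2.2 + 1) * (z.2.1 + z.2.2 + 1)) :=
    Primrec.nat_mul.comp (Primrec.const 8) (Primrec.nat_mul.comp hN hN)
  have hk : Primrec heightBound :=
    Primrec.nat_mul.comp (Primrec.list_length.comp (Primrec.snd.comp Primrec.fst))
      (Primrec.nat_mul.comp hM hM)
  have hm : Primrec fun z : TorsionInput => ruleBound z.1 :=
    Primrec.succ.comp (Primrec.list_length.comp (Primrec.list_flatMap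
      (Primrec.snd.comp Primrec.fst) (Primrec.snd.comp Primrec.snd)))
  have hpow : Primrec₂ ((· ^ ·) : ℕ → ℕ → ℕ) :=
    Primrec₂.unpaired'.1 Nat.Primrec.pow
  exact hpow.comp hm hk

theorem primrec_torsionSucc {P : Type} [Primcodable P] {t p i : P → ℕ} (ht : Primrec t)
    (hp : Primrec p) (hi : Primrec i) : Primrec fun z => torsionSucc (t z) (p z) (i z) :=
  Primrec.ite (Primrec.nat_lt.comp (Primrec.succ.comp hi) (Primrec.nat_add.comp ht hp))
    (Primrec.succ.comp hi) ht

theorem primrec_scanStep {P : Type} [Primcodable P] {t p : P → ℕ} (ht : Primrec t)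
    (hp : Primrec p) {s : P → ScanState} (hs : Primrec s) {c : P → Letter} (hc : Primrec c) :
    Primrec fun z => scanStep (torsionSucc (t z) (p z)) (s z) (c z) := by
  have hfc : Primrec fun z => ((s z).1, c z) := Primrec.pair (Primrec.fst.comp hs) hc
  -- Any test of phase and letter is a function on a finite type, hence primitive recursive.
  have hdec : ∀ (q : Fin 8 × Letter → Prop), PrimrecPred fun z => q ((s z).1, c z) := fun q => by
    classical
    exact PrimrecPred.comp (p := q) (Primrec.dom_finite _).primrecPred hfc
  have hi : Primrec fun z => (s z).2.1 := Primrec.fst.comp (Primrec.snd.comp hs)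
  have hj : Primrec fun z => (s z).2.2 := Primrec.snd.comp (Primrec.snd.comp hs)
  have h0 := primrec_torsionSucc ht hp (Primrec.const 0)
  refine Primrec.pair ?_ (Primrec.pair ?_ ?_)
  · exact (Primrec.dom_finite fun x : Fin 8 × Letter => nextPhase x.1 x.2).comp hfc
  · exact Primrec.ite (hdec fun x => x.2 = letterB ∧ (x.1 = 1 ∨ x.1 = 4)) h0
      (Primrec.ite (hdec fun x => x.2 = letterB ∧ x.1 = 2) (primrec_torsionSucc ht hp hi) hi)
  · exact Primrec.ite (hdec fun x => x.2 = letterB ∧ x.1 = 5) h0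
      (Primrec.ite (hdec fun x => x.2 = letterB ∧ x.1 = 6) (primrec_torsionSucc ht hp hj) hj)

theorem primrec_scanEmit : Primrec₂ scanEmit := by
  have hfc : Primrec fun z : ScanState × Letter => (z.1.1, z.2) :=
    Primrec.pair (Primrec.fst.comp Primrec.fst) Primrec.snd
  have hdec : ∀ (q : Fin 8 × Letter → Prop),
      PrimrecPred fun z : ScanState × Letter => q (z.1.1, z.2) := fun q => by
    classical
    exact PrimrecPred.comp (p := q) (Primrec.dom_finite _).primrecPred hfc
  have hi : Primrec fun z : ScanState × Letter => z.1.2.1 :=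
    Primrec.fst.comp (Primrec.snd.comp Primrec.fst)
  have hj : Primrec fun z : ScanState × Letter => z.1.2.2 :=
    Primrec.snd.comp (Primrec.snd.comp Primrec.fst)
  exact Primrec.ite (hdec fun x => x.2 = letterB ∧ x.1 = 4)
    (Primrec.option_some.comp (Primrec.pair hi (Primrec.const none)))
    (Primrec.ite (hdec fun x => x.2 = letterA ∧ x.1 = 6)
      (Primrec.option_some.comp (Primrec.pair hi (Primrec.option_some.comp hj)))
      (Primrec.const none))

theorem primrec_boundedPush : Primrec fun z : ℕ × List GraphCode × Option GraphCode =>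
    boundedPush z.1 z.2.1 z.2.2 := by
  have hcount : Primrec₂ fun (v : List GraphCode) (c : GraphCode) => v.count c := by
    have h := Primrec.list_length.comp (PrimrecRel.listFilter (Primrec.eq (α := GraphCode)))
    refine h.of_eq fun z => ?_
    change _ = List.count z.2 z.1
    rw [List.count_eq_length_filter]
    congr 1
    refine List.filter_congr fun x _ => ?_
    exact (Bool.beq_eq_decide_eq _ _).symm
  have hif : Primrec₂ fun (z : ℕ × List GraphCode × Option GraphCode) (c : GraphCode) =>
      if z.2.1.count c ≤ z.1 then c :: z.2.1 else z.2.1 := by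
    have hv : Primrec fun y : (ℕ × List GraphCode × Option GraphCode) × GraphCode => y.1.2.1 :=
      Primrec.fst.comp (Primrec.snd.comp Primrec.fst)
    exact Primrec.ite (Primrec.nat_le.comp (hcount.comp hv Primrec.snd)
      (Primrec.fst.comp Primrec.fst)) (Primrec.list_cons.comp Primrec.snd hv) hv
  refine (Primrec.option_casesOn (Primrec.snd.comp Primrec.snd)
    (Primrec.fst.comp Primrec.snd) hif).of_eq fun z => ?_
  obtain ⟨B, v, o⟩ := z
  cases o <;> rfl

theorem primrec_memoryStep :
    Primrec fun x : TorsionInput × (ScanState × List GraphCode) × Letter =>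
      memoryStep (torsionSucc x.1.2.1 x.1.2.2) (pumpBound x.1) x.2.1 x.2.2 := by
  have hs : Primrec fun x : TorsionInput × (ScanState × List GraphCode) × Letter => x.2.1.1 :=
    Primrec.fst.comp (Primrec.fst.comp Primrec.snd)
  have hv : Primrec fun x : TorsionInput × (ScanState × List GraphCode) × Letter => x.2.1.2 :=
    Primrec.snd.comp (Primrec.fst.comp Primrec.snd)
  have hc : Primrec fun x : TorsionInput × (ScanState × List GraphCode) × Letter => x.2.2 :=
    Primrec.snd.comp Primrec.snd
  refine Primrec.pair (primrec_scanStep ?_ ?_ hs hc) (primrec_boundedPush.comp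
    (Primrec.pair (primrec_pumpBound.comp Primrec.fst)
      (Primrec.pair hv (primrec_scanEmit.comp hs hc))))
  · exact Primrec.fst.comp (Primrec.snd.comp Primrec.fst)
  · exact Primrec.snd.comp (Primrec.snd.comp Primrec.fst)

/-! ### Correctness of the construction -/

/-- A word that leads to the same state of the transducer with memory as a word of the language
represents the graph of some word of the language. -/
theorem exists_wordGraph_eq {g : GrammarCode} {t p : ℕ} (hp : 1 ≤ p)
    (hg : g.language ≤ graphWords) (hL : TorsionProperty g.language t p) {w w₁ : List Letter}
    (hw₁ : w₁ ∈ g.language)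
    (h : w₁.foldl (memoryStep (torsionSucc t p) (pumpBound (g, t, p))) (scanStart, []) =
      w.foldl (memoryStep (torsionSucc t p) (pumpBound (g, t, p))) (scanStart, [])) :
    w ∈ graphWords ∧ ∃ w' ∈ g.language, wordGraph w' = wordGraph w := by
  have hr0 : torsionReduce t p 0 = 0 := rfl
  have hrs : ∀ i, torsionReduce t p (i + 1) = torsionSucc t p (torsionReduce t p i) :=
    fun _ => rfl
  obtain ⟨h1, h2⟩ := foldl_memoryStep (torsionSucc t p) (pumpBound (g, t, p)) w scanStart []
    (by simp)
  obtain ⟨h3, h4⟩ := foldl_memoryStep (torsionSucc t p) (pumpBound (g, t, p)) w₁ scanStart []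
    (by simp)
  rw [h] at h3 h4
  have hst : w₁.foldl (scanStep (torsionSucc t p)) scanStart =
      w.foldl (scanStep (torsionSucc t p)) scanStart := h3.symm.trans h1
  have hcnt : ∀ x, min ((outputs (scanStep (torsionSucc t p)) scanEmit scanStart w₁).count x)
      (pumpBound (g, t, p) + 1) =
      min ((outputs (scanStep (torsionSucc t p)) scanEmit scanStart w).count x)
      (pumpBound (g, t, p) + 1) := fun x => by
    simpa using (h4 x).symm.trans (h2 x)
  have hphase : ∀ v : List Letter, v ∈ graphWords ↔
      (v.foldl (scanStep (torsionSucc t p)) scanStart).Final := fun v => by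
    rw [mem_graphWords_iff, foldl_scanStart hr0 hrs]
    rfl
  have hw : w ∈ graphWords := by
    rw [hphase, ← hst, ← hphase]
    exact hg hw₁
  refine ⟨hw, ?_⟩
  have hmax : ∀ r ∈ g.2, r.2.length ≤ ruleBound g := fun r hr =>
    ((List.sublist_flatten_of_mem (List.mem_map_of_mem hr)).length_le).trans (Nat.le_succ _)
  -- The target of the pumping is the reduced output of `w`. A code that `w₁` outputs less often
  -- than `w` must have reached the cap `pumpBound + 1` in both, because the truncated counts agree;
  -- this is why the memory counts one beyond the bound.
  obtain ⟨w₂, hw₂, hst₂, hle, hsub⟩ := exists_yields_le_outputs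
    (k := heightBound (g, t, p)) (em := scanEmit) (Nat.succ_le_succ (Nat.zero_le _)) hmax
    (boundedStates_finite (t + p)) (scanStep_mem_boundedStates (torsionSucc_le t p))
    (by rw [ncard_boundedStates]; exact le_rfl)
    (s := scanStart) ⟨trivial, Nat.zero_le _, Nat.zero_le _⟩
    (outputs (scanStep (torsionSucc t p)) scanEmit scanStart w : Multiset GraphCode)
    ((g.mem_language_iff w₁).1 hw₁) (fun x hx => by
      have := hcnt x
      rw [Multiset.coe_count] at hx
      have e : instBEqOfDecidableEq = (instBEqProd : BEq GraphCode) := lawful_beq_subsingleton _ _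
      rw [e] at hx ⊢
      change pumpBound (g, t, p) < _
      lia)
  have hw₂L : w₂ ∈ g.language := (g.mem_language_iff w₂).2 hw₂
  have hw₂G := hg hw₂L
  have hcodes : scanCodes (torsionSucc t p) w₂ =
      outputs (scanStep (torsionSucc t p)) scanEmit scanStart w₂ ++
        scanPending (w.foldl (scanStep (torsionSucc t p)) scanStart) := by
    rw [scanCodes, hst₂, hst]
  have hX : (scanCodes Nat.succ w).map (GraphCode.map (torsionReduce t p)) =
      outputs (scanStep (torsionSucc t p)) scanEmit scanStart w ++
        scanPending (w.foldl (scanStep (torsionSucc t p)) scanStart) :=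
    (scanCodes_map hr0 hrs w).symm
  -- The reduced codes of `w₂` are lifted to codes of `w`, all of which are used. The pending codes
  -- agree because `w₂` and `w` end in the same transducer state.
  obtain ⟨Z, hZ, hZw⟩ := exists_map_eq_of_subperm (GraphCode.map (torsionReduce t p))
    (scanCodes Nat.succ w) (scanCodes (torsionSucc t p) w₂)
    (by
      rw [hX, hcodes]
      exact (List.subperm_append_right _).2 (Multiset.coe_le.1 hle))
    (fun y hy => by
      rw [hcodes] at hy
      rw [hX]
      rcases List.mem_append.1 hy with hy | hy
      · refine List.mem_append_left _ (List.count_pos_iff.1 ?_)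
        have h1 := List.count_pos_iff.2 (hsub hy)
        have := hcnt y
        lia
      · exact List.mem_append_right _ hy)
  have hvalid : ∀ c ∈ Z, c.Valid := fun c hc =>
    (eq_flatMap_scanCodes ((mem_graphWords_iff w).1 hw)).2 c ((hZw c).1 hc)
  obtain ⟨hfin, hcodesZ⟩ := scanCodes_flatMap_word hvalid
  refine ⟨Z.flatMap GraphCode.word, ?_, wordGraph_eq ((mem_graphWords_iff _).2 hfin) hw
    fun c => by rw [hcodesZ, hZw]⟩
  -- `Z` and the codes of `w₂` have the same reductions in the same order, so torsion transfers
  -- membership from `w₂` to the word spelled by `Z`.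
  have hmem := flatMap_mem_iff_of_map_eq hp hL (hZ.trans (scanCodes_map hr0 hrs w₂)) []
  rw [List.nil_append, List.nil_append,
    ← (eq_flatMap_scanCodes ((mem_graphWords_iff w₂).1 hw₂G)).1] at hmem
  exact hmem.2 hw₂L

theorem rho_eq_of_labelledRho_eq {L L' : Language Letter} (h : labelledRho L = labelledRho L') :
    rho L = rho L' := by
  have : ∀ L : Language Letter, rho L = Quotient.mk _ '' labelledRho L := by
    intro L
    ext c
    constructor
    · rintro ⟨w, hw, rfl⟩
      exact ⟨_, ⟨w, hw, rfl⟩, rfl⟩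
    · rintro ⟨_, ⟨w, hw, rfl⟩, rfl⟩
      exact ⟨w, hw, rfl⟩
  rw [this, this, h]

/-- There is an algorithm which, given a context-free grammar for a language `L ⊆ 𝔾` and numbers
`t`, `p` with `p ≥ 1` such that `L` has the `(b, t, p)`-torsion property, computes a finite
automaton for a (regular) language `R ⊆ 𝔾` with `ρ(R) = ρ(L)`, even without identifying
isomorphic graphs. -/
theorem mainTheorem6 :
    ∃ f : GrammarCode × ℕ × ℕ → NFACode, Computable f ∧
      ∀ (g : GrammarCode) (t p : ℕ), 1 ≤ p →
        g.language ≤ graphWords →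
        TorsionProperty g.language t p →
        (f (g, t, p)).language.IsRegular ∧
        (f (g, t, p)).language ≤ graphWords ∧
        rho (f (g, t, p)).language = rho g.language ∧
        labelledRho (f (g, t, p)).language = labelledRho g.language := by
  obtain ⟨f, hf, hfw⟩ := exists_computable_nfaCode (P := TorsionInput)
    (fun z => memoryStep (torsionSucc z.2.1 z.2.2) (pumpBound z)) primrec_memoryStep
    (fun _ => (scanStart, [])) (Primrec.const _)
    (fun z => exists_finite_memoryStep (torsionSucc_le z.2.1 z.2.2) _)
    (fun z => z.1.2) (Primrec.snd.comp Primrec.fst) (fun z => z.1.1)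
    (Primrec.fst.comp Primrec.fst)
  refine ⟨f, hf, fun g t p hp hg hL => ?_⟩
  have key : ∀ w ∈ (f (g, t, p)).language,
      w ∈ graphWords ∧ ∃ w' ∈ g.language, wordGraph w' = wordGraph w := fun w hw => by
    obtain ⟨w₁, hw₁, h⟩ := (hfw (g, t, p) w).1 hw
    exact exists_wordGraph_eq hp hg hL ((g.mem_language_iff w₁).2 hw₁) h
  have hlab : labelledRho (f (g, t, p)).language = labelledRho g.language := by
    ext G
    constructor
    · rintro ⟨w, hw, rfl⟩
      obtain ⟨-, w', hw', h⟩ := key w hw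
      exact ⟨w', hw', h.symm⟩
    · rintro ⟨w, hw, rfl⟩
      -- A word of the language leads to the same state as itself, so it is accepted.
      exact ⟨w, (hfw (g, t, p) w).2 ⟨w, (g.mem_language_iff w).1 hw, rfl⟩, rfl⟩
  exact ⟨(isRegular_iff_exists_nfaCode _).2 ⟨_, rfl⟩, fun w hw => (key w hw).1,
    rho_eq_of_labelledRho_eq hlab, hlab⟩
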